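/- Let $\mathcal{M}$ be the group of real Möbius transformations $z\mapsto (az+b)/(cz+d)$, $a,b,c,d\in\mathbb{R}$, $ad-bc>0$, acting on the extended complex plane $\overline{\mathbb{C}}$ and preserving the upper half-plane $\mathbb{H}$ and the extended real line $\overline{\mathbb{R}}=\mathbb{R}\cup\{\infty\}$. Let $\chi$ be the chordal metric on $\overline{\mathbb{C}}$, and equip $\mathcal{M}$ with the metric $\chi_0(f,g)=\sup_{z\in\overline{\mathbb{C}}}\chi(f(z),g(z))$. A semigroup is a nonempty subset $S$ of $\mathcal{M}$ that is closed under composition; it is finitely generated if, for some finite subset $\mathcal{F}$ of $S$, every element of $S$ is a finite composition of elements of $\mathcal{F}$; and it is semidiscrete if the identity transformation is not an accumulation point of $S$ in $\mathcal{M}$. Fix a point $w\in\mathbb{H}$. The forward limit set $\Lambda^+(S)$ is the set of points of $\overline{\mathbb{R}}$ that are accumulation points, with respect to $\chi$, of $\{g(w) : g\in S\}$, and the backward limit set is $\Lambda^-(S)=\Lambda^+(S^{-1})$, where $S^{-1}=\{g^{-1} : g\in S\}$. (These sets do not depend on the choice of $w$.) Theorem. Let $S$ be a finitely generated semidiscrete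 semigroup such that $|\Lambda^-(S)|\neq 1$. Then $\Lambda^+(S)=\Lambda^-(S)$ if and only if $S$ is a group. Moreover, if $\Lambda^-(S)\subseteq\Lambda^+(S)$, then $S$ is a group. -/

import Mathlib

open scoped Pointwise UpperHalfPlane

noncomputable section

namespace MoebiusSemigroup

/-- The group of real Moebius transformations, as a group of bijections of the extended complex
plane `OnePoint ℂ` under composition: the maps `z ↦ (a z + b) / (c z + d)` with `a, b, c, d` real
and `a d - b c > 0`, with the usual conventions at `∞` and at the pole. -/
def realMoebiusGroup : Subgroup (Equiv.Perm (OnePoint ℂ)) :=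
  (Matrix.GLPos (Fin 2) ℝ).map
    ((MulAction.toPermHom (Matrix.GeneralLinearGroup (Fin 2) ℂ) (OnePoint ℂ)).comp
      (Matrix.GeneralLinearGroup.map Complex.ofRealHom))

/-- The type of real Moebius transformations. -/
abbrev RealMoebius : Type := ↥realMoebiusGroup

/-- The chordal metric on the extended complex plane. -/
def chordal : OnePoint ℂ → OnePoint ℂ → ℝ
  | OnePoint.some z, OnePoint.some w =>
      2 * ‖z - w‖ / (Real.sqrt (1 + ‖z‖ ^ 2) * Real.sqrt (1 + ‖w‖ ^ 2))
  | OnePoint.some z, OnePoint.infty => 2 / Real.sqrt (1 + ‖z‖ ^ 2)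
  | OnePoint.infty, OnePoint.some w => 2 / Real.sqrt (1 + ‖w‖ ^ 2)
  | OnePoint.infty, OnePoint.infty => 0

/-- The metric of uniform convergence on the Moebius group with respect to the chordal metric.
The supremum is over a set of reals bounded by `2`. -/
def uniformDist (f g : RealMoebius) : ℝ :=
  ⨆ z : OnePoint ℂ, chordal (f.1 z) (g.1 z)

/-- `p` is an accumulation point of the set `A` with respect to the distance function `d`. -/
def IsAccumulationPoint {X : Type*} (d : X → X → ℝ) (p : X) (A : Set X) : Prop :=
  ∀ ε : ℝ, 0 < ε → ∃ a ∈ A, a ≠ p ∧ d a p < ε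

/-- A semigroup is semidiscrete if the identity transformation is not an accumulation point of it
in the Moebius group. -/
def IsSemidiscrete (S : Subsemigroup RealMoebius) : Prop :=
  ¬ IsAccumulationPoint uniformDist 1 (S : Set RealMoebius)

/-- A semigroup is finitely generated if every element is a finite composition (of length at
least one) of elements of some finite subset. -/
def IsFinitelyGenerated (S : Subsemigroup RealMoebius) : Prop :=
  ∃ F : Set RealMoebius, F.Finite ∧ Subsemigroup.closure F = S

/-- The semigroup `S` is a group under composition. -/
def IsGroup (S : Subsemigroup RealMoebius) : Prop :=
  ∃ H : Subgroup RealMoebius, (H : Set RealMoebius) = (S : Set RealMoebius)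

/-- The extended real line, as a subset of the extended complex plane. -/
def extendedRealLine : Set (OnePoint ℂ) :=
  insert OnePoint.infty (Set.range fun x : ℝ => ((x : ℂ) : OnePoint ℂ))

/-- The orbit of the point `w` of the upper half-plane under a set of transformations. -/
def orbitOf (w : ℍ) (S : Set RealMoebius) : Set (OnePoint ℂ) :=
  {z | ∃ g ∈ S, g.1 ((w : ℂ) : OnePoint ℂ) = z}

/-- The forward limit set, computed from the base point `w` of the upper half-plane: the
accumulation points in the extended real line of the orbit of `w`. -/
def forwardLimitSet (w : ℍ) (S : Set RealMoebius) : Set (OnePoint ℂ) :=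
  {p | p ∈ extendedRealLine ∧ IsAccumulationPoint chordal p (orbitOf w S)}

/-- The backward limit set: the forward limit set of the set of inverses. -/
def backwardLimitSet (w : ℍ) (S : Set RealMoebius) : Set (OnePoint ℂ) :=
  forwardLimitSet w S⁻¹

end MoebiusSemigroup

end

noncomputable section

namespace MoebiusSemigroup

/-! ### Hyperbolic distance and the action near the boundary -/

open Filter Topology Matrix MatrixGroups

/-! Lift `S` to its full preimage `T` in SL(2, ℝ). The heart is a uniform return property
(`exists_forall_cone`): some `R` works for every `u ∈ T`, in that an element of `uT ∪ {u}` moves `w`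
by at most `R`.

Given this and `s ∈ T`, choose bounded elements `u (n + 1)` of `T` in the cone of `u n * s`. By
compactness some `(u m)⁻¹ * u n` with `m < n` is close to 1. It lies in `sT ∪ {s}`, so by
semidiscreteness it acts trivially and `s` is invertible in `S` (`exists_mul_eq_one`).

For the return property, call a backward limit point `p` horospherical if some `v ∈ T` increases the
Poisson kernel at `p` from `w` to `v • w`. If all are, compactness makes a suitable `v` shrink the
displacement of every far `u` by a fixed factor, and iteration brings it back
(`exists_contraction`).

Otherwise put a nonhorospherical `p` at `∞`, so that no orbit point is higher than `w`. If `v ∈ T`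
has a finite pole `q`, distant orbit points avoid a wide sector around the vertical geodesic at `q`,
as `v` would lift them too high. If return fails, some cone is far away throughout. Its orbit moves
in bounded steps and cannot cross these walls, yet by `Λ⁻ ⊆ Λ⁺` it accumulates at every backward
limit point. Two poles then trap it in a strip, contradicting accumulation at `∞`; a single pole
makes `T` preserve a geodesic, which fixes an angle that the sector forbids; no pole at all leaves
`∞` as the only possible backward limit point. -/

/-- A Möbius invariant distance function on the upper half-plane, `4 sinh² (ρ / 2)`. -/
def sqDist (z w : ℍ) : ℝ := ‖(z : ℂ) - w‖ ^ 2 / (z.im * w.im)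

lemma sqDist_eq (z w : ℍ) : sqDist z w = 2 * (Real.cosh (dist z w) - 1) := by
  rw [UpperHalfPlane.cosh_dist, sqDist, dist_eq_norm]
  have := z.im_pos
  have := w.im_pos
  field_simp
  ring

lemma sqDist_smul (g : SL(2, ℝ)) (z w : ℍ) : sqDist (g • z) (g • w) = sqDist z w := by
  rw [sqDist_eq, sqDist_eq, dist_smul]

lemma sqDist_comm (z w : ℍ) : sqDist z w = sqDist w z := by
  rw [sqDist_eq, sqDist_eq, dist_comm]

lemma sqDist_inv_smul (g : SL(2, ℝ)) (z w : ℍ) : sqDist z (g⁻¹ • w) = sqDist (g • z) w := by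
  rw [← sqDist_smul g z, smul_inv_smul]

/-- The trace on the upper half-plane of the neighbourhood filter of a point of the extended
real line. -/
def boundaryFilter : OnePoint ℝ → Filter ℍ
  | OnePoint.infty => comap (fun z : ℍ => (z : ℂ)) (Bornology.cobounded ℂ)
  | OnePoint.some x => comap (fun z : ℍ => (z : ℂ)) (𝓝 (x : ℂ))

lemma coe_smul_eq (g : SL(2, ℝ)) (z : ℍ) :
    ((g • z : ℍ) : ℂ) = ((g 0 0 : ℝ) * (z : ℂ) + (g 0 1 : ℝ)) /
      ((g 1 0 : ℝ) * (z : ℂ) + (g 1 1 : ℝ)) := by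
  rw [UpperHalfPlane.coe_specialLinearGroup_apply]
  simp

lemma denom_ne (g : SL(2, ℝ)) (z : ℍ) : ((g 1 0 : ℝ) : ℂ) * (z : ℂ) + (g 1 1 : ℝ) ≠ 0 := by
  simpa [UpperHalfPlane.denom] using UpperHalfPlane.denom_ne_zero (g : GL (Fin 2) ℝ) z

lemma normSq_denom (g : SL(2, ℝ)) (z : ℍ) :
    Complex.normSq (((g 1 0 : ℝ) : ℂ) * (z : ℂ) + (g 1 1 : ℝ)) =
      (g 1 0 * z.re + g 1 1) ^ 2 + (g 1 0 * z.im) ^ 2 := by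
  rw [Complex.normSq_apply]; simp; ring

lemma im_smul_eq (g : SL(2, ℝ)) (z : ℍ) :
    (g • z).im = z.im / ((g 1 0 * z.re + g 1 1) ^ 2 + (g 1 0 * z.im) ^ 2) := by
  have h := denom_ne g z
  have hd := g.det_coe
  rw [Matrix.det_fin_two] at hd
  rw [← UpperHalfPlane.coe_im, coe_smul_eq, Complex.div_im]
  rw [normSq_denom, ← sub_div]
  congr 1
  simp
  linear_combination z.im * hd

lemma det_eq (g : SL(2, ℝ)) : g 0 0 * g 1 1 - g 0 1 * g 1 0 = 1 := by
  have hd := g.det_coe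
  rwa [Matrix.det_fin_two] at hd

lemma smul_coe_eq (g : SL(2, ℝ)) (x : ℝ) : (g : GL (Fin 2) ℝ) • (x : OnePoint ℝ) =
    if g 1 0 * x + g 1 1 = 0 then OnePoint.infty
    else (((g 0 0 * x + g 0 1) / (g 1 0 * x + g 1 1) : ℝ) : OnePoint ℝ) := by
  rw [OnePoint.smul_some_eq_ite]; simp; congr

lemma smul_infty_eq (g : SL(2, ℝ)) : (g : GL (Fin 2) ℝ) • (OnePoint.infty : OnePoint ℝ) =
    if g 1 0 = 0 then OnePoint.infty else ((g 0 0 / g 1 0 : ℝ) : OnePoint ℝ) := by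
  rw [OnePoint.smul_infty_eq_ite]; simp; congr

lemma tendsto_smul_boundaryFilter (g : SL(2, ℝ)) (p : OnePoint ℝ) :
    Tendsto (fun z : ℍ => g • z) (boundaryFilter p)
      (boundaryFilter ((g : GL (Fin 2) ℝ) • p)) := by
  have hd := det_eq g
  induction p using OnePoint.rec with
  | infty =>
    rw [smul_infty_eq]
    have hz : Tendsto (fun z : ℍ => (z : ℂ)) (boundaryFilter OnePoint.infty)
      (Bornology.cobounded ℂ) := tendsto_comap
    split_ifs with hc
    · refine tendsto_comap_iff.2 ?_
      have hd1 : g 1 1 ≠ 0 := by rintro h; simp [h, hc] at hd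
      have ha : g 0 0 ≠ 0 := by rintro h; simp [h, hc] at hd
      have : ((fun z : ℍ => (z : ℂ)) ∘ fun z : ℍ => g • z) =
          fun z : ℍ => ((g 0 0 : ℝ) / (g 1 1 : ℝ) : ℂ) * (z : ℂ) + (g 0 1 : ℝ) / (g 1 1 : ℝ) := by
        funext z
        have : ((g 1 1 : ℝ) : ℂ) ≠ 0 := by exact_mod_cast hd1
        simp only [Function.comp, coe_smul_eq, hc]
        rw [Complex.ofReal_zero, zero_mul, zero_add, add_div, mul_div_right_comm]
      rw [this]
      have hk : ((g 0 0 : ℝ) / (g 1 1 : ℝ) : ℂ) ≠ 0 := by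
        exact_mod_cast div_ne_zero ha hd1
      have := (tendsto_mul_left_cobounded hk).comp hz
      exact (tendsto_add_const_cobounded _).comp this
    · refine tendsto_comap_iff.2 ?_
      have hc' : ((g 1 0 : ℝ) : ℂ) ≠ 0 := by exact_mod_cast hc
      -- Since the determinant is 1, `gz = a/c - 1/(c(cz + d))`, and the last term vanishes as `z →
      -- ∞`.
      have : ((fun z : ℍ => (z : ℂ)) ∘ fun z : ℍ => g • z) =
          fun z : ℍ => ((g 0 0 / g 1 0 : ℝ) : ℂ) -
            (((g 1 0 : ℝ) : ℂ) * (((g 1 0 : ℝ) : ℂ) * (z : ℂ) + (g 1 1 : ℝ)))⁻¹ := by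
        funext z
        have h1 := denom_ne g z
        have hd' : ((g 0 0 : ℝ) : ℂ) * (g 1 1 : ℝ) - (g 0 1 : ℝ) * (g 1 0 : ℝ) = 1 := by
          exact_mod_cast hd
        simp only [Function.comp, coe_smul_eq]
        push_cast
        generalize (z : ℂ) = z at *
        generalize ((g 0 0 : ℝ) : ℂ) = a at *
        generalize ((g 0 1 : ℝ) : ℂ) = b at *
        generalize ((g 1 0 : ℝ) : ℂ) = c at *
        generalize ((g 1 1 : ℝ) : ℂ) = d at *
        rw [div_eq_iff h1, sub_mul, mul_inv, mul_assoc, inv_mul_cancel₀ h1]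
        field_simp
        linear_combination (-1 : ℂ) * hd'
      rw [this]
      have h1 := (tendsto_mul_left_cobounded hc').comp
        ((tendsto_add_const_cobounded ((g 1 1 : ℝ) : ℂ)).comp
          ((tendsto_mul_left_cobounded hc').comp hz))
      simpa using (tendsto_const_nhds (x := ((g 0 0 / g 1 0 : ℝ) : ℂ))).sub
        (tendsto_inv₀_cobounded.comp h1)
  | coe x =>
    rw [smul_coe_eq]
    have hz : Tendsto (fun z : ℍ => (z : ℂ)) (boundaryFilter (x : OnePoint ℝ))
      (𝓝 (x : ℂ)) := tendsto_comap
    have hn := (hz.const_mul ((g 0 0 : ℝ) : ℂ)).add_const ((g 0 1 : ℝ) : ℂ)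
    have hde := (hz.const_mul ((g 1 0 : ℝ) : ℂ)).add_const ((g 1 1 : ℝ) : ℂ)
    split_ifs with hc
    · refine tendsto_comap_iff.2 ?_
      have hc' : ((g 1 0 : ℝ) : ℂ) * x + (g 1 1 : ℝ) = 0 := by exact_mod_cast hc
      have hne : ((g 0 0 : ℝ) : ℂ) * x + (g 0 1 : ℝ) ≠ 0 := by
        intro h
        have h : g 0 0 * x + g 0 1 = 0 := by exact_mod_cast h
        have : (1 : ℝ) = 0 := by
          rw [← hd]; linear_combination g 0 0 * hc - g 1 0 * h
        norm_num at this
      rw [hc'] at hde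
      have hde' : Tendsto (fun z : ℍ => (((g 1 0 : ℝ) : ℂ) * (z : ℂ) + (g 1 1 : ℝ))⁻¹)
          (boundaryFilter (x : OnePoint ℝ)) (Bornology.cobounded ℂ) :=
        tendsto_inv₀_nhdsNE_zero.comp
          (tendsto_nhdsWithin_iff.2 ⟨hde, Eventually.of_forall fun z => denom_ne g z⟩)
      have : ((fun z : ℍ => (z : ℂ)) ∘ fun z : ℍ => g • z) = fun z : ℍ =>
          (((g 0 0 : ℝ) : ℂ) * (z : ℂ) + (g 0 1 : ℝ)) *
            (((g 1 0 : ℝ) : ℂ) * (z : ℂ) + (g 1 1 : ℝ))⁻¹ := by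
        funext z
        simp only [Function.comp, coe_smul_eq, div_eq_mul_inv]
      rw [this, ← tendsto_norm_atTop_iff_cobounded]
      simp only [norm_mul]
      exact hn.norm.pos_mul_atTop (norm_pos_iff.2 hne) (tendsto_norm_atTop_iff_cobounded.2 hde')
    · refine tendsto_comap_iff.2 ?_
      have hc' : ((g 1 0 : ℝ) : ℂ) * x + (g 1 1 : ℝ) ≠ 0 := by exact_mod_cast hc
      have := hn.div hde hc'
      convert this using 1
      · funext z; exact coe_smul_eq g z
      · push_cast; rfl

/-! ### Limit sets of sets of matrices -/

/-- The forward limit set of a set of unimodular real matrices, as a subset of `OnePoint ℝ`. -/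
def limitSet (w : ℍ) (M : Set SL(2, ℝ)) : Set (OnePoint ℝ) :=
  {p | ∃ᶠ z in boundaryFilter p, ∃ v ∈ M, v • w = z}

lemma smul_mem_limitSet {w : ℍ} {M N : Set SL(2, ℝ)} (g : SL(2, ℝ))
    (h : ∀ v ∈ M, g * v ∈ N) {p : OnePoint ℝ} (hp : p ∈ limitSet w M) :
    (g : GL (Fin 2) ℝ) • p ∈ limitSet w N := by
  refine (tendsto_smul_boundaryFilter g p).frequently (Frequently.mono hp ?_)
  rintro _ ⟨v, hv, rfl⟩
  exact ⟨g * v, h v hv, mul_smul _ _ _⟩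

lemma exists_norm_gt_of_infty_mem {w : ℍ} {M : Set SL(2, ℝ)}
    (h : OnePoint.infty ∈ limitSet w M) (B : ℝ) : ∃ v ∈ M, B < ‖((v • w : ℍ) : ℂ)‖ := by
  have : ∀ᶠ z : ℍ in boundaryFilter OnePoint.infty, B < ‖(z : ℂ)‖ :=
    (tendsto_norm_cobounded_atTop.comp tendsto_comap).eventually_gt_atTop B
  obtain ⟨_, ⟨v, hv, rfl⟩, hB⟩ := (Frequently.and_eventually h this).exists
  exact ⟨v, hv, hB⟩

lemma exists_norm_sub_lt_of_coe_mem {w : ℍ} {M : Set SL(2, ℝ)} {x : ℝ}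
    (h : (x : OnePoint ℝ) ∈ limitSet w M) {ε : ℝ} (hε : 0 < ε) :
    ∃ v ∈ M, ‖((v • w : ℍ) : ℂ) - x‖ < ε := by
  have : ∀ᶠ z : ℍ in boundaryFilter (x : OnePoint ℝ), ‖(z : ℂ) - x‖ < ε := by
    have h : Tendsto (fun z : ℍ => (z : ℂ)) (boundaryFilter (x : OnePoint ℝ)) (𝓝 (x : ℂ)) :=
      tendsto_comap
    simpa [dist_eq_norm] using (Metric.tendsto_nhds.1 h) ε hε
  obtain ⟨_, ⟨v, hv, rfl⟩, hB⟩ := (Frequently.and_eventually h this).exists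
  exact ⟨v, hv, hB⟩

lemma abs_re_sub_le (z : ℍ) (x : ℝ) : |z.re - x| ≤ ‖(z : ℂ) - x‖ := by
  simpa using Complex.abs_re_le_norm ((z : ℂ) - x)

lemma im_le_norm_sub (z : ℍ) (x : ℝ) : z.im ≤ ‖(z : ℂ) - x‖ := by
  simpa [abs_of_pos z.im_pos] using Complex.abs_im_le_norm ((z : ℂ) - x)

lemma norm_sub_sq (z w : ℍ) : ‖(z : ℂ) - w‖ ^ 2 = (z.re - w.re) ^ 2 + (z.im - w.im) ^ 2 := by
  rw [← Complex.normSq_eq_norm_sq, Complex.normSq_apply]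
  simp
  ring

lemma re_smul_eq (g : SL(2, ℝ)) (z : ℍ) :
    (g • z).re = ((g 0 0 * z.re + g 0 1) * (g 1 0 * z.re + g 1 1) + g 0 0 * g 1 0 * z.im ^ 2) /
      ((g 1 0 * z.re + g 1 1) ^ 2 + (g 1 0 * z.im) ^ 2) := by
  rw [← UpperHalfPlane.coe_re, coe_smul_eq, Complex.div_re]
  rw [normSq_denom, ← add_div]
  congr 1
  simp
  ring

lemma normSq_denom_pos (g : SL(2, ℝ)) (z : ℍ) :
    0 < (g 1 0 * z.re + g 1 1) ^ 2 + (g 1 0 * z.im) ^ 2 := by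
  rw [← normSq_denom]
  exact Complex.normSq_pos.2 (denom_ne g z)

lemma inv_smul_infty_eq {g : SL(2, ℝ)} (hc : g 1 0 ≠ 0) :
    ((g⁻¹ : SL(2, ℝ)) : GL (Fin 2) ℝ) • (OnePoint.infty : OnePoint ℝ) =
      ((-g 1 1 / g 1 0 : ℝ) : OnePoint ℝ) := by
  rw [smul_infty_eq, Matrix.SpecialLinearGroup.SL2_inv_expl]
  simp [hc, neg_div, div_neg]

/-! ### A nonhorospherical backward limit point at infinity -/

/-- If every element of the semigroup fixes `∞` and does not increase the height of the base point,
then the backward orbit stays away from the real line. -/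
lemma eq_infty_of_mem_backward {w : ℍ} {T : Set SL(2, ℝ)}
    (him : ∀ v ∈ T, (v • w).im ≤ w.im) (hc : ∀ v ∈ T, v 1 0 = 0) {p : OnePoint ℝ}
    (hp : p ∈ limitSet w T⁻¹) : p = OnePoint.infty := by
  induction p using OnePoint.rec with
  | infty => rfl
  | coe x =>
    obtain ⟨v, hv, hlt⟩ := exists_norm_sub_lt_of_coe_mem hp w.im_pos
    exfalso
    have h1 := (im_le_norm_sub (v • w) x).trans_lt hlt
    have h2 := him _ hv
    have h3 := hc _ hv
    have hd := det_eq v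
    have hw := w.im_pos
    rw [im_smul_eq] at h1 h2
    rw [Matrix.SpecialLinearGroup.SL2_inv_expl] at h2 h3
    simp at h2 h3
    simp only [h3] at h1 h2 hd
    have ha : v 0 0 ≠ 0 := by rintro h; simp [h] at hd
    have hd1 : v 1 1 ≠ 0 := by rintro h; simp [h] at hd
    have ha2 : 0 < v 0 0 ^ 2 := by positivity
    have hd2 : 0 < v 1 1 ^ 2 := by positivity
    simp at h1 h2
    rw [div_le_iff₀ ha2] at h2
    rw [div_lt_iff₀ hd2] at h1
    -- `v` and `v⁻¹` scale heights by `1/d²` and `1/a²`, which are reciprocal because `ad = 1`; so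
    -- they cannot satisfy both bounds.
    have h4 : 1 ≤ v 0 0 ^ 2 := by nlinarith
    have h5 : 1 < v 1 1 ^ 2 := by nlinarith
    have h6 : v 0 0 ^ 2 * v 1 1 ^ 2 = 1 := by
      rw [← mul_pow]; simp at hd; rw [hd]; norm_num
    nlinarith

/-- Points of low height whose image under `g` also has low height are far from the vertical
geodesic ending at `g⁻¹ ∞`, up to a bounded set. -/
lemma exists_forall_mul_im_le_abs_re_sub (w : ℍ) {g : SL(2, ℝ)} (hc : g 1 0 ≠ 0) (K : ℝ) :
    ∃ R : ℝ, ∀ z : ℍ, z.im ≤ w.im → (g • z).im ≤ w.im → R < sqDist z w →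
      K * z.im ≤ |z.re - -g 1 1 / g 1 0| := by
  set q := -g 1 1 / g 1 0 with hq
  -- Where `|Re z - q| < K Im z`, the height of `gz` is at least `1/(c²(K² + 1) Im z)`. Hence `Im gz
  -- ≤ Im w` forces `Im z ≥ m`, and such `z` stay in a bounded region.
  set m : ℝ := 1 / (w.im * (g 1 0 ^ 2 * (K ^ 2 + 1))) with hm
  have hw := w.im_pos
  have hc2 : 0 < g 1 0 ^ 2 := by positivity
  have hm0 : 0 < m := by positivity
  refine ⟨((|K| * w.im + |q - w.re|) ^ 2 + w.im ^ 2) / (m * w.im), fun z hz hgz hR => ?_⟩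
  by_contra! hlt
  have hz0 := z.im_pos
  have hd : g 1 1 = -(g 1 0 * q) := by rw [hq]; field_simp
  have hKz : 0 < K * z.im := (abs_nonneg _).trans_lt hlt
  have hK : 0 < K := pos_of_mul_pos_left hKz hz0.le
  have hsq : (z.re - q) ^ 2 ≤ (K * z.im) ^ 2 := sq_le_sq' (by linarith [(abs_lt.1 hlt).1])
    (abs_lt.1 hlt).2.le
  have hmz : m ≤ z.im := by
    have hp := normSq_denom_pos g z
    rw [im_smul_eq, div_le_iff₀ hp] at hgz
    have h1 : (g 1 0 * z.re + g 1 1) ^ 2 + (g 1 0 * z.im) ^ 2 ≤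
        g 1 0 ^ 2 * (K ^ 2 + 1) * z.im ^ 2 := by
      rw [hd]
      nlinarith
    have h2 : z.im ≤ w.im * (g 1 0 ^ 2 * (K ^ 2 + 1)) * z.im * z.im := by
      nlinarith
    rw [hm, div_le_iff₀ (by positivity)]
    by_contra! h3
    nlinarith
  refine hR.not_ge ?_
  rw [sqDist, norm_sub_sq]
  have h1 : (z.re - w.re) ^ 2 ≤ (|K| * w.im + |q - w.re|) ^ 2 := by
    rw [← sq_abs (z.re - w.re)]
    refine pow_le_pow_left₀ (abs_nonneg _) ?_ 2
    have : |z.re - w.re| ≤ |z.re - q| + |q - w.re| := abs_sub_le _ _ _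
    rw [abs_of_pos hK]
    nlinarith
  have h2 : (z.im - w.im) ^ 2 ≤ w.im ^ 2 := by nlinarith
  gcongr

/-- Two points on opposite sides of the sector differ horizontally by at least `K(y + y')`, whose
square is at least `4K²yy'`. A jump across therefore costs at least `4K² > C`. -/
lemma lt_re_of_sqDist_le {K C q : ℝ} (hK : 0 ≤ K) (hKC : C < 4 * K ^ 2) {z z' : ℍ}
    (hz : K * z.im ≤ |z.re - q|) (hz' : K * z'.im ≤ |z'.re - q|) (hd : sqDist z z' ≤ C)
    (hlt : q < z.re) : q < z'.re := by
  by_contra! hle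
  have h0 := z.im_pos
  have h0' := z'.im_pos
  rw [abs_of_pos (sub_pos.2 hlt)] at hz
  rw [abs_of_nonpos (sub_nonpos.2 hle)] at hz'
  rw [sqDist, norm_sub_sq, div_le_iff₀ (by positivity)] at hd
  have h1 : K * (z.im + z'.im) ≤ z.re - z'.re := by linarith
  have h2 : (K * (z.im + z'.im)) ^ 2 ≤ (z.re - z'.re) ^ 2 :=
    pow_le_pow_left₀ (by positivity) h1 2
  have h3 : 0 < z.im * z'.im := by positivity
  have h4 : C * (z.im * z'.im) < 4 * K ^ 2 * (z.im * z'.im) := by gcongr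
  have h5 : K ^ 2 * (4 * (z.im * z'.im)) ≤ K ^ 2 * (z.im + z'.im) ^ 2 := by
    refine mul_le_mul_of_nonneg_left ?_ (sq_nonneg K)
    nlinarith [sq_nonneg (z.im - z'.im)]
  nlinarith [sq_nonneg (z.im - z'.im)]

/-- The cone `u T ∪ {u}`. -/
def cone (T : Subsemigroup SL(2, ℝ)) (u : SL(2, ℝ)) : Set SL(2, ℝ) :=
  {t | t = u ∨ ∃ v ∈ T, t = u * v}

lemma mul_mem_cone {T : Subsemigroup SL(2, ℝ)} {u t s : SL(2, ℝ)} (ht : t ∈ cone T u)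
    (hs : s ∈ T) : t * s ∈ cone T u := by
  rcases ht with rfl | ⟨v, hv, rfl⟩
  · exact Or.inr ⟨s, hs, rfl⟩
  · exact Or.inr ⟨v * s, T.mul_mem hv hs, mul_assoc _ _ _⟩

lemma mem_of_mem_cone {T : Subsemigroup SL(2, ℝ)} {u t : SL(2, ℝ)} (hu : u ∈ T)
    (ht : t ∈ cone T u) : t ∈ T := by
  rcases ht with rfl | ⟨v, hv, rfl⟩
  exacts [hu, T.mul_mem hu hv]

lemma mul_mem_cone_self {T : Subsemigroup SL(2, ℝ)} {u v : SL(2, ℝ)} (hv : v ∈ T) :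
    u * v ∈ cone T u := Or.inr ⟨v, hv, rfl⟩

/-- The orbit of a cone is coarsely connected, so it cannot jump across a wall. -/
lemma lt_re_iff_of_mem_cone {w : ℍ} {T : Subsemigroup SL(2, ℝ)} {F : Set SL(2, ℝ)}
    (hF : Subsemigroup.closure F = T) {C : ℝ} (hC : ∀ f ∈ F, sqDist (f • w) w ≤ C)
    {K q : ℝ} (hK : 0 ≤ K) (hKC : C < 4 * K ^ 2) {u : SL(2, ℝ)}
    (hw : ∀ t ∈ cone T u, K * (t • w).im ≤ |(t • w).re - q|) {v : SL(2, ℝ)} (hv : v ∈ T) :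
    q < ((u * v) • w).re ↔ q < (u • w).re := by
  -- The base `t` varies so that words can be split. Appending a generator on the right is a step of
  -- size at most `C`, since `t` is an isometry.
  have key : ∀ s ∈ Subsemigroup.closure F, ∀ t ∈ cone T u,
      (q < ((t * s) • w).re ↔ q < (t • w).re) := by
    intro s hs
    induction hs using Subsemigroup.closure_induction with
    | mem f hf =>
      intro t ht
      have h1 := hw t ht
      have h2 := hw (t * f) (mul_mem_cone ht (hF ▸ Subsemigroup.subset_closure hf))
      have h3 : sqDist ((t * f) • w) (t • w) ≤ C := by
        rw [mul_smul, sqDist_smul]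
        exact hC f hf
      exact ⟨lt_re_of_sqDist_le hK hKC h2 h1 h3,
        lt_re_of_sqDist_le hK hKC h1 h2 (by rwa [sqDist_comm])⟩
    | mul x y hx hy ihx ihy =>
      intro t ht
      rw [← mul_assoc, ihy _ (mul_mem_cone ht (hF ▸ hx)), ihx _ ht]
  exact key v (hF ▸ hv) u (Or.inl rfl)

/-- The backward limit set is mapped into itself by `u⁻¹`. Thus `u⁻¹p` is also a forward limit
point, and applying `u` puts `p` in the limit set of `uT`. -/
lemma mem_limitSet_of_mem_backward {w : ℍ} {T : Subsemigroup SL(2, ℝ)}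
    (hsub : limitSet w (T : Set SL(2, ℝ))⁻¹ ⊆ limitSet w T) {u : SL(2, ℝ)} (hu : u ∈ T)
    {p : OnePoint ℝ} (hp : p ∈ limitSet w (T : Set SL(2, ℝ))⁻¹) :
    p ∈ limitSet w ((fun v => u * v) '' (T : Set SL(2, ℝ))) := by
  have h1 : ((u⁻¹ : SL(2, ℝ)) : GL (Fin 2) ℝ) • p ∈ limitSet w (T : Set SL(2, ℝ))⁻¹ := by
    refine smul_mem_limitSet u⁻¹ (fun v hv => ?_) hp
    have : v⁻¹ ∈ T := hv
    simpa using T.mul_mem this hu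
  have h2 := smul_mem_limitSet (N := (fun v => u * v) '' (T : Set SL(2, ℝ))) u
    (fun v hv => ⟨v, hv, rfl⟩) (hsub h1)
  simpa [smul_smul] using h2

/-- Two distinct finite poles of elements of the semigroup confine a deep cone to a bounded
region. -/
lemma false_of_two_poles {w : ℍ} {T : Subsemigroup SL(2, ℝ)} {F : Set SL(2, ℝ)}
    (hF : Subsemigroup.closure F = T) {C : ℝ} (hC : ∀ f ∈ F, sqDist (f • w) w ≤ C)
    (him : ∀ v ∈ T, (v • w).im ≤ w.im)
    (hsub : limitSet w (T : Set SL(2, ℝ))⁻¹ ⊆ limitSet w T)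
    (hinf : OnePoint.infty ∈ limitSet w (T : Set SL(2, ℝ))⁻¹)
    (hbad : ∀ R : ℝ, ∃ u ∈ T, ∀ t ∈ cone T u, R < sqDist (t • w) w)
    {v₁ v₂ : SL(2, ℝ)} (hv₁ : v₁ ∈ T) (hv₂ : v₂ ∈ T) (hc₁ : v₁ 1 0 ≠ 0) (hc₂ : v₂ 1 0 ≠ 0)
    (hlt : -v₁ 1 1 / v₁ 1 0 < -v₂ 1 1 / v₂ 1 0) : False := by
  set K : ℝ := |C| + 1 with hK
  have hKC : C < 4 * K ^ 2 := by
    have := le_abs_self C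
    have := abs_nonneg C
    nlinarith
  have hK0 : 0 ≤ K := by positivity
  obtain ⟨R₁, hR₁⟩ := exists_forall_mul_im_le_abs_re_sub w hc₁ K
  obtain ⟨R₂, hR₂⟩ := exists_forall_mul_im_le_abs_re_sub w hc₂ K
  obtain ⟨u, hu, hbad⟩ := hbad (max R₁ R₂)
  -- The pole of `v` is `v⁻¹∞`, a backward limit point because `∞` is one.
  have hq : ∀ {v : SL(2, ℝ)}, v ∈ T → v 1 0 ≠ 0 → ((-v 1 1 / v 1 0 : ℝ) : OnePoint ℝ) ∈
      limitSet w ((fun v => u * v) '' (T : Set SL(2, ℝ))) := by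
    intro v hv hc
    refine mem_limitSet_of_mem_backward hsub hu ?_
    rw [← inv_smul_infty_eq hc]
    refine smul_mem_limitSet v⁻¹ (fun s hs => ?_) hinf
    have : s⁻¹ ∈ T := hs
    simpa using T.mul_mem this hv
  have hq₁ := hq hv₁ hc₁
  have hq₂ := hq hv₂ hc₂
  have hw : ∀ {v : SL(2, ℝ)} {R : ℝ}, v ∈ T → R ≤ max R₁ R₂ → (∀ z : ℍ, z.im ≤ w.im →
      (v • z).im ≤ w.im → R < sqDist z w → K * z.im ≤ |z.re - -v 1 1 / v 1 0|) →
      ∀ t ∈ cone T u, K * (t • w).im ≤ |(t • w).re - -v 1 1 / v 1 0| := by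
    intro v R hv hR h t ht
    have htT := mem_of_mem_cone hu ht
    refine h _ (him t htT) ?_ (hR.trans_lt (hbad t ht))
    rw [← mul_smul]
    exact him _ (T.mul_mem hv htT)
  have hw₁ := hw hv₁ (le_max_left _ _) hR₁
  have hw₂ := hw hv₂ (le_max_right _ _) hR₂
  have hi₁ := fun {v} hv => lt_re_iff_of_mem_cone hF hC hK0 hKC hw₁ (v := v) hv
  have hi₂ := fun {v} hv => lt_re_iff_of_mem_cone hF hC hK0 hKC hw₂ (v := v) hv
  set q₁ := -v₁ 1 1 / v₁ 1 0
  set q₂ := -v₂ 1 1 / v₂ 1 0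
  -- Accumulation at `q₂` puts some point of the cone to the right of the wall at `q₁`, hence all of
  -- them; symmetrically below.
  have hu₁ : q₁ < (u • w).re := by
    obtain ⟨_, ⟨v, hv, rfl⟩, h⟩ := exists_norm_sub_lt_of_coe_mem hq₂ (sub_pos.2 hlt)
    rw [← hi₁ hv]
    have := (abs_lt.1 ((abs_re_sub_le _ _).trans_lt h)).1
    simp only at this
    linarith
  have hu₂ : ¬ q₂ < (u • w).re := by
    obtain ⟨_, ⟨v, hv, rfl⟩, h⟩ := exists_norm_sub_lt_of_coe_mem hq₁ (sub_pos.2 hlt)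
    rw [← hi₂ hv]
    have := (abs_lt.1 ((abs_re_sub_le _ _).trans_lt h)).2
    simp only at this
    linarith
  obtain ⟨_, ⟨v, hv, rfl⟩, h⟩ := exists_norm_gt_of_infty_mem
    (mem_limitSet_of_mem_backward hsub hu hinf) (|q₁| + |q₂| + w.im)
  have h1 := (hi₁ hv).2 hu₁
  have h2 := mt (hi₂ hv).1 hu₂
  have h3 := him _ (T.mul_mem hu hv)
  have h4 := Complex.norm_le_abs_re_add_abs_im (((u * v) • w : ℍ) : ℂ)
  rw [UpperHalfPlane.coe_re, UpperHalfPlane.coe_im, abs_of_pos (UpperHalfPlane.im_pos _)] at h4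
  have h5 : |((u * v) • w).re| ≤ |q₁| + |q₂| := by
    rw [abs_le]
    constructor
    · linarith [neg_abs_le q₁, abs_nonneg q₂]
    · linarith [le_abs_self q₂, abs_nonneg q₁]
  simp only at h
  linarith

/-- If all poles of elements of the semigroup are equal to `∞` or to `q`, then the semigroup
preserves the geodesic from `q` to `∞`. -/
lemma abs_re_sub_mul_im_eq {T : Subsemigroup SL(2, ℝ)} {v₁ u : SL(2, ℝ)} (hv₁ : v₁ ∈ T)
    (hu : u ∈ T) (hc₁ : v₁ 1 0 ≠ 0) {q : ℝ}
    (hq : ∀ v ∈ T, v 1 0 ≠ 0 → -v 1 1 / v 1 0 = q) (w : ℍ) :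
    |(u • w).re - q| * w.im = |w.re - q| * (u • w).im := by
  have hp := normSq_denom_pos u w
  have hd := det_eq u
  have hq₁ := hq v₁ hv₁ hc₁
  rw [div_eq_iff hc₁] at hq₁
  -- The pole of `v₁u` is `u⁻¹q`, so `u⁻¹q` is `q` or `∞`. Below, `u` either fixes both `q` and `∞`
  -- or swaps them.
  have h2 := hq (v₁ * u) (T.mul_mem hv₁ hu)
  have e1 : (v₁ * u) 1 0 = v₁ 1 0 * u 0 0 + v₁ 1 1 * u 1 0 := by
    simp [Matrix.mul_apply, Fin.sum_univ_two]
  have e2 : (v₁ * u) 1 1 = v₁ 1 0 * u 0 1 + v₁ 1 1 * u 1 1 := by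
    simp [Matrix.mul_apply, Fin.sum_univ_two]
  have hq' : v₁ 1 1 = -(q * v₁ 1 0) := by linarith
  rw [e1, e2, hq'] at h2
  have h3 : u 0 0 - q * u 1 0 ≠ 0 → -(u 0 1 - q * u 1 1) = q * (u 0 0 - q * u 1 0) := by
    intro h
    have h4 : v₁ 1 0 * u 0 0 + -(q * v₁ 1 0) * u 1 0 ≠ 0 := by
      convert mul_ne_zero hc₁ h using 1
      ring
    have := h2 h4
    rw [div_eq_iff h4] at this
    refine mul_left_cancel₀ hc₁ ?_
    linear_combination this
  rw [re_smul_eq, im_smul_eq]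
  have key : ((u 0 0 * w.re + u 0 1) * (u 1 0 * w.re + u 1 1) + u 0 0 * u 1 0 * w.im ^ 2) -
      q * ((u 1 0 * w.re + u 1 1) ^ 2 + (u 1 0 * w.im) ^ 2) = w.re - q ∨
      ((u 0 0 * w.re + u 0 1) * (u 1 0 * w.re + u 1 1) + u 0 0 * u 1 0 * w.im ^ 2) -
      q * ((u 1 0 * w.re + u 1 1) ^ 2 + (u 1 0 * w.im) ^ 2) = -(w.re - q) := by
    by_cases hc : u 1 0 = 0
    · left
      rw [hc] at h3 hd ⊢
      have ha : u 0 0 - q * 0 ≠ 0 := by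
        intro h
        have : u 0 0 = 0 := by linarith
        simp [this] at hd
      have := h3 ha
      linear_combination (w.re - q) * hd - u 1 1 * this
    · right
      have h5 := hq u hu hc
      rw [div_eq_iff hc] at h5
      have ha : u 0 0 - q * u 1 0 = 0 := by
        by_contra h
        have h6 := h3 h
        have h7 : u 0 1 = - q * u 0 0 := by
          linear_combination -h6 - q * h5
        have : (1 : ℝ) = 0 := by
          rw [← hd, h7]; linear_combination -u 0 0 * h5
        norm_num at this
      have h8 : u 0 0 = q * u 1 0 := by linarith
      have h9 : u 1 1 = -(q * u 1 0) := by linarith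
      rw [h8, h9] at hd ⊢
      linear_combination (-(w.re - q)) * hd
  rw [div_sub' hp.ne', abs_div, abs_of_pos hp]
  rw [mul_comm _ q]
  rcases key with key | key
  · rw [key]; ring
  · rw [key, abs_neg]; ring

/-- The key contradiction, for a semigroup for which `∞` is a nonhorospherical point. -/
theorem false_of_nonhorospherical_infty {w : ℍ} {T : Subsemigroup SL(2, ℝ)} {F : Set SL(2, ℝ)}
    (hF : Subsemigroup.closure F = T) {C : ℝ} (hC : ∀ f ∈ F, sqDist (f • w) w ≤ C)
    (him : ∀ v ∈ T, (v • w).im ≤ w.im)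
    (hsub : limitSet w (T : Set SL(2, ℝ))⁻¹ ⊆ limitSet w T)
    (hinf : OnePoint.infty ∈ limitSet w (T : Set SL(2, ℝ))⁻¹)
    (hne : ∃ p ∈ limitSet w (T : Set SL(2, ℝ))⁻¹, p ≠ OnePoint.infty)
    (hbad : ∀ R : ℝ, ∃ u ∈ T, ∀ t ∈ cone T u, R < sqDist (t • w) w) : False := by
  by_cases hc : ∀ v ∈ T, v 1 0 = 0
  · obtain ⟨p, hp, hp'⟩ := hne
    exact hp' (eq_infty_of_mem_backward him hc hp)
  push Not at hc
  obtain ⟨v₁, hv₁, hc₁⟩ := hc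
  by_cases hq : ∀ v ∈ T, v 1 0 ≠ 0 → -v 1 1 / v 1 0 = -v₁ 1 1 / v₁ 1 0
  -- `K` is chosen larger than `|Re w - q| / Im w`, a ratio that is constant along the orbit.
  · obtain ⟨R, hR⟩ := exists_forall_mul_im_le_abs_re_sub w hc₁
      ((|w.re - -v₁ 1 1 / v₁ 1 0| + 1) / w.im)
    obtain ⟨u, hu, hbad⟩ := hbad R
    have h1 := hR (u • w) (him u hu) (by rw [← mul_smul]; exact him _ (T.mul_mem hv₁ hu))
      (hbad u (Or.inl rfl))
    have h2 := abs_re_sub_mul_im_eq hv₁ hu hc₁ hq w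
    have hw := w.im_pos
    have hw' := (u • w).im_pos
    have h3 := mul_le_mul_of_nonneg_right h1 hw.le
    rw [h2, mul_right_comm, div_mul_cancel₀ _ hw.ne'] at h3
    nlinarith
  · push Not at hq
    obtain ⟨v₂, hv₂, hc₂, hne₂⟩ := hq
    rcases lt_or_gt_of_ne hne₂ with h | h
    · exact false_of_two_poles hF hC him hsub hinf hbad hv₂ hv₁ hc₂ hc₁ h
    · exact false_of_two_poles hF hC him hsub hinf hbad hv₁ hv₂ hc₁ hc₂ h

/-! ### Horospherical points, contraction and the return property -/

/-- The Poisson kernel of the upper half-plane. -/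
def poisson : OnePoint ℝ → ℍ → ℝ
  | OnePoint.infty, z => z.im
  | OnePoint.some x, z => z.im / ((z.re - x) ^ 2 + z.im ^ 2)

lemma poisson_pos (p : OnePoint ℝ) (z : ℍ) : 0 < poisson p z := by
  have := z.im_pos
  induction p using OnePoint.rec with
  | infty => exact this
  | coe x => simp only [poisson]; positivity

/-- This turns Poisson kernel inequalities at `p` into height inequalities at `∞`. For finite `x`
the map is `z ↦ -1/(z - x)`. -/
lemma exists_smul_eq_infty (p : OnePoint ℝ) : ∃ A : SL(2, ℝ),
    (A : GL (Fin 2) ℝ) • p = OnePoint.infty ∧ ∀ z : ℍ, (A • z).im = poisson p z := by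
  induction p using OnePoint.rec with
  | infty => exact ⟨1, by simp, fun z => by simp [poisson]⟩
  | coe x =>
    obtain ⟨A, hA⟩ : ∃ A : SL(2, ℝ), (A : Matrix (Fin 2) (Fin 2) ℝ) = !![0, -1; 1, -x] :=
      ⟨⟨!![0, -1; 1, -x], by simp⟩, rfl⟩
    refine ⟨A, ?_, fun z => ?_⟩
    · rw [smul_coe_eq, hA]; simp
    · rw [im_smul_eq, hA]; simp [poisson, sub_eq_add_neg]

/-- The height of `z` cancels in the quotient, so the limit exists at the boundary; it is the
exponential of a Busemann function. -/
lemma tendsto_sqDist_div_sqDist (p : OnePoint ℝ) (v w : ℍ) :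
    Tendsto (fun z => sqDist z v / sqDist z w) (boundaryFilter p)
      (𝓝 (poisson p w / poisson p v)) := by
  have hv := v.im_pos
  have hw := w.im_pos
  have heq : ∀ z : ℍ, sqDist z v / sqDist z w =
      (‖(z : ℂ) - v‖ / ‖(z : ℂ) - w‖) ^ 2 * (w.im / v.im) := by
    intro z
    have hz := z.im_pos
    rw [sqDist, sqDist, div_pow]
    by_cases h : ‖(z : ℂ) - w‖ = 0
    · simp [h]
    · field_simp
  simp only [heq]
  induction p using OnePoint.rec with
  | infty =>
    have hz : Tendsto (fun z : ℍ => (z : ℂ)) (boundaryFilter OnePoint.infty)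
      (Bornology.cobounded ℂ) := tendsto_comap
    have h1 : Tendsto (fun z : ℍ => (z : ℂ) - w) (boundaryFilter OnePoint.infty)
      (Bornology.cobounded ℂ) := by
      simpa [sub_eq_add_neg, Function.comp_def] using
        (tendsto_add_const_cobounded (-(w : ℂ))).comp hz
    have h2 : Tendsto (fun z : ℍ => 1 + ((w : ℂ) - v) * ((z : ℂ) - w)⁻¹)
        (boundaryFilter OnePoint.infty) (𝓝 (1 + ((w : ℂ) - v) * 0)) :=
      ((tendsto_inv₀_cobounded.comp h1).const_mul _).const_add _
    have h3 : ∀ᶠ z : ℍ in boundaryFilter OnePoint.infty, ‖(z : ℂ) - w‖ > 0 :=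
      (tendsto_norm_cobounded_atTop.comp h1).eventually_gt_atTop 0
    have h4 : Tendsto (fun z : ℍ => (‖(z : ℂ) - v‖ / ‖(z : ℂ) - w‖) ^ 2 * (w.im / v.im))
        (boundaryFilter OnePoint.infty) (𝓝 (‖1 + ((w : ℂ) - v) * 0‖ ^ 2 * (w.im / v.im))) := by
      refine ((h2.norm.pow 2).mul_const _).congr' ?_
      filter_upwards [h3] with z hz
      rw [← norm_div]
      have : (z : ℂ) - w ≠ 0 := norm_pos_iff.1 hz
      congr 3
      field_simp
      ring
    simpa [poisson] using h4
  | coe x =>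
    have hz : Tendsto (fun z : ℍ => (z : ℂ)) (boundaryFilter (x : OnePoint ℝ))
      (𝓝 (x : ℂ)) := tendsto_comap
    have hsq : ∀ z : ℍ, ‖(x : ℂ) - z‖ ^ 2 = (z.re - x) ^ 2 + z.im ^ 2 := by
      intro z
      rw [← Complex.normSq_eq_norm_sq, Complex.normSq_apply]
      simp
      ring
    have hne : ‖(x : ℂ) - w‖ ≠ 0 := by
      intro h
      have := hsq w
      rw [h] at this
      nlinarith [sq_nonneg (w.re - x)]
    have h1 := ((((hz.sub_const (v : ℂ)).norm.div (hz.sub_const (w : ℂ)).norm hne).pow 2).mul_const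
      (w.im / v.im))
    refine (congrArg (fun r => Tendsto _ _ (𝓝 r)) ?_).mp h1
    rw [div_pow, hsq, hsq]
    simp only [poisson]
    have h2 : 0 < (v.re - x) ^ 2 + v.im ^ 2 := by positivity
    have h3 : 0 < (w.re - x) ^ 2 + w.im ^ 2 := by positivity
    field_simp

/-- An ultrafilter that escapes to infinity in the hyperbolic plane converges to a boundary
point. -/
lemma exists_le_boundaryFilter {w : ℍ} {U : Ultrafilter ℍ}
    (h : Tendsto (fun z => sqDist z w) U atTop) : ∃ p, (U : Filter ℍ) ≤ boundaryFilter p := by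
  by_cases hb : Tendsto (fun z : ℍ => (z : ℂ)) U (Bornology.cobounded ℂ)
  · exact ⟨OnePoint.infty, tendsto_iff_comap.1 hb⟩
  rw [← tendsto_norm_atTop_iff_cobounded, tendsto_atTop] at hb
  push Not at hb
  obtain ⟨B, hB⟩ := hb
  have hball : (U.map fun z : ℍ => (z : ℂ) : Filter ℂ) ≤ 𝓟 (Metric.closedBall 0 B) := by
    rw [le_principal_iff]
    exact hB.mono fun z hz => by simpa using hz.le
  obtain ⟨a, -, ha⟩ := (isCompact_closedBall (0 : ℂ) B).ultrafilter_le_nhds _ hball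
  have ha : Tendsto (fun z : ℍ => (z : ℂ)) U (𝓝 a) := ha
  have him : Tendsto (fun z : ℍ => z.im) U (𝓝 a.im) := (Complex.continuous_im.tendsto a).comp ha
  have ha0 : 0 ≤ a.im := ge_of_tendsto him (Eventually.of_forall fun z => z.im_pos.le)
  -- A limit of positive height would make `sqDist` converge instead of escaping.
  rcases ha0.eq_or_lt with h0 | h0
  · refine ⟨((a.re : ℝ) : OnePoint ℝ), tendsto_iff_comap.1 ?_⟩
    have : ((a.re : ℝ) : ℂ) = a := Complex.ext (by simp) (by simp [h0])
    rw [this]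
    exact ha
  · exfalso
    have hlim := ((ha.sub_const (w : ℂ)).norm.pow 2).div (him.mul_const w.im)
      (mul_pos h0 w.im_pos).ne'
    exact not_tendsto_nhds_of_tendsto_atTop h _ hlim

/-- If no constants work, take counterexamples `u n` for `R = n` and `θ = 1 - 1/(n + 1)`. The points
`(u n)⁻¹ • w` converge along an ultrafilter to a backward limit point `p`. For a `v` that increases
the kernel at `p`, the displacement ratios tend to a limit below 1, against the choice of `u n`. -/
lemma exists_contraction {w : ℍ} {T : Subsemigroup SL(2, ℝ)}
    (h : ∀ p ∈ limitSet w (T : Set SL(2, ℝ))⁻¹, ∃ v ∈ T, poisson p w < poisson p (v • w)) :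
    ∃ R θ : ℝ, 0 ≤ R ∧ 0 ≤ θ ∧ θ < 1 ∧ ∀ u ∈ T, R < sqDist (u • w) w →
      ∃ v ∈ T, sqDist ((u * v) • w) w ≤ θ * sqDist (u • w) w := by
  by_contra! hcon
  have hθ : ∀ n : ℕ, 0 ≤ 1 - 1 / ((n : ℝ) + 1) ∧ 1 - 1 / ((n : ℝ) + 1) < 1 := by
    intro n
    have h1 : 0 < 1 / ((n : ℝ) + 1) := by positivity
    have h2 : 1 / ((n : ℝ) + 1) ≤ 1 := by
      rw [div_le_one (by positivity)]
      linarith [(n.cast_nonneg : (0 : ℝ) ≤ n)]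
    constructor <;> linarith
  choose u hu hlarge hlow using fun n : ℕ =>
    hcon n (1 - 1 / ((n : ℝ) + 1)) n.cast_nonneg (hθ n).1 (hθ n).2
  let x : ℕ → ℍ := fun n => (u n)⁻¹ • w
  have hx : ∀ n, sqDist (x n) w = sqDist (u n • w) w := by
    intro n
    rw [sqDist_comm, sqDist_inv_smul]
  have hxv : ∀ n (v : SL(2, ℝ)), sqDist (x n) (v • w) = sqDist ((u n * v) • w) w := by
    intro n v
    rw [sqDist_comm, sqDist_inv_smul, mul_smul]
  let U : Ultrafilter ℍ := (hyperfilter ℕ).map x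
  have hU : Tendsto (fun z => sqDist z w) U atTop := by
    have : Tendsto (fun n : ℕ => sqDist (x n) w) atTop atTop :=
      tendsto_atTop_mono (fun n => by rw [hx]; exact (hlarge n).le) tendsto_natCast_atTop_atTop
    exact tendsto_map'_iff.2 (this.mono_left Nat.hyperfilter_le_atTop)
  obtain ⟨p, hp⟩ := exists_le_boundaryFilter hU
  have hpmem : p ∈ limitSet w (T : Set SL(2, ℝ))⁻¹ := by
    have : ∀ᶠ z in (U : Filter ℍ), ∃ v ∈ (T : Set SL(2, ℝ))⁻¹, v • w = z :=
      Eventually.of_forall (f := (hyperfilter ℕ : Filter ℕ))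
        fun n => ⟨(u n)⁻¹, by simpa using hu n, rfl⟩
    exact this.frequently.filter_mono hp
  obtain ⟨v, hv, hlt⟩ := h p hpmem
  have hlim : Tendsto (fun n => sqDist (x n) (v • w) / sqDist (x n) w) (hyperfilter ℕ)
      (𝓝 (poisson p w / poisson p (v • w))) :=
    tendsto_map'_iff.1 ((tendsto_sqDist_div_sqDist p (v • w) w).mono_left hp)
  have hone : Tendsto (fun n : ℕ => 1 - 1 / ((n : ℝ) + 1)) (hyperfilter ℕ) (𝓝 (1 - 0)) :=
    (tendsto_one_div_add_atTop_nhds_zero_nat.const_sub 1).mono_left Nat.hyperfilter_le_atTop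
  have hle : 1 - 0 ≤ poisson p w / poisson p (v • w) := by
    refine le_of_tendsto_of_tendsto hone hlim (Eventually.of_forall fun n => ?_)
    have hpos : 0 < sqDist (u n • w) w := (n.cast_nonneg).trans_lt (hlarge n)
    simp only
    rw [hx, hxv, le_div_iff₀ hpos]
    exact (hlow n v hv).le
  rw [sub_zero, le_div_iff₀ (poisson_pos _ _), one_mul] at hle
  exact hle.not_gt hlt

/-- If every backward limit point is horospherical, then the orbit of every cone comes back to a
bounded region. -/
lemma exists_forall_cone_of_horospherical {w : ℍ} {T : Subsemigroup SL(2, ℝ)}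
    (h : ∀ p ∈ limitSet w (T : Set SL(2, ℝ))⁻¹, ∃ v ∈ T, poisson p w < poisson p (v • w)) :
    ∃ R : ℝ, ∀ u ∈ T, ∃ t ∈ cone T u, sqDist (t • w) w ≤ R := by
  obtain ⟨R, θ, hR, hθ0, hθ1, hstep⟩ := exists_contraction h
  refine ⟨R + 1, fun u hu => ?_⟩
  have key : ∀ n : ℕ, ∃ t ∈ cone T u, sqDist (t • w) w ≤ R ∨
      sqDist (t • w) w ≤ θ ^ n * sqDist (u • w) w := by
    intro n
    induction n with
    | zero => exact ⟨u, Or.inl rfl, Or.inr (by simp)⟩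
    | succ n ih =>
      obtain ⟨t, ht, hle⟩ := ih
      by_cases hR' : sqDist (t • w) w ≤ R
      · exact ⟨t, ht, Or.inl hR'⟩
      · obtain ⟨v, hv, hle'⟩ := hstep t (mem_of_mem_cone hu ht) (not_le.1 hR')
        refine ⟨t * v, mul_mem_cone ht hv, Or.inr (hle'.trans ?_)⟩
        rw [pow_succ', mul_assoc]
        exact mul_le_mul_of_nonneg_left (hle.resolve_left hR') hθ0
  have hlim : Tendsto (fun n : ℕ => θ ^ n * sqDist (u • w) w) atTop (𝓝 (0 * sqDist (u • w) w)) :=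
    (tendsto_pow_atTop_nhds_zero_of_lt_one hθ0 hθ1).mul_const _
  rw [zero_mul] at hlim
  obtain ⟨n, hn⟩ := (hlim.eventually_lt_const (show (0 : ℝ) < R + 1 by linarith)).exists
  obtain ⟨t, ht, hle⟩ := key n
  exact ⟨t, ht, by rcases hle with h | h <;> linarith⟩

/-- A nonhorospherical `p` is conjugated to `∞`; the second backward limit point from `hcard` is
what excludes a semigroup without finite poles. -/
theorem exists_forall_cone {w : ℍ} {T : Subsemigroup SL(2, ℝ)} {F : Set SL(2, ℝ)}
    (hF : Subsemigroup.closure F = T) {C : ℝ} (hC : ∀ f ∈ F, sqDist (f • w) w ≤ C)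
    (hsub : limitSet w (T : Set SL(2, ℝ))⁻¹ ⊆ limitSet w T)
    (hcard : ∀ p ∈ limitSet w (T : Set SL(2, ℝ))⁻¹, ∃ q ∈ limitSet w (T : Set SL(2, ℝ))⁻¹, q ≠ p) :
    ∃ R : ℝ, ∀ u ∈ T, ∃ t ∈ cone T u, sqDist (t • w) w ≤ R := by
  by_cases h : ∀ p ∈ limitSet w (T : Set SL(2, ℝ))⁻¹, ∃ v ∈ T, poisson p w < poisson p (v • w)
  · exact exists_forall_cone_of_horospherical h
  push Not at h
  obtain ⟨p, hp, hle⟩ := h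
  obtain ⟨q, hq, hqp⟩ := hcard p hp
  by_contra! hbad
  obtain ⟨A, hAp, hA⟩ := exists_smul_eq_infty p
  let φ : SL(2, ℝ) →ₙ* SL(2, ℝ) := (MulAut.conj A).toMulHom
  have hφ : ∀ g, φ g = A * g * A⁻¹ := fun g => rfl
  have hsm : ∀ g, φ g • A • w = A • g • w := by
    intro g
    rw [hφ, mul_smul, mul_smul, inv_smul_smul]
  have hlim : ∀ {M N : Set SL(2, ℝ)} (B : SL(2, ℝ)) (w' : ℍ), (∀ g ∈ M, B * g * B⁻¹ ∈ N) →
      ∀ r ∈ limitSet w' M, (B : GL (Fin 2) ℝ) • r ∈ limitSet (B • w') N := by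
    intro M N B w' hMN r hr
    refine (tendsto_smul_boundaryFilter B r).frequently (Frequently.mono hr ?_)
    rintro _ ⟨g, hg, rfl⟩
    exact ⟨B * g * B⁻¹, hMN g hg, by rw [mul_smul, mul_smul, inv_smul_smul]⟩
  have hfwd := hlim (M := T) (N := (T.map φ : Set SL(2, ℝ))) A w fun g hg => ⟨g, hg, rfl⟩
  have hbwd := hlim (M := (T : Set SL(2, ℝ))⁻¹) (N := (T.map φ : Set SL(2, ℝ))⁻¹) A w
    fun g hg => ⟨g⁻¹, hg, by rw [hφ]; group⟩
  have hbwd' := hlim (N := (T : Set SL(2, ℝ))⁻¹) (M := (T.map φ : Set SL(2, ℝ))⁻¹) A⁻¹ (A • w)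
    (by
      rintro g ⟨s, hs, hsg⟩
      have : g = A * s⁻¹ * A⁻¹ := by
        rw [← inv_inv g, ← hsg, hφ]; group
      rw [this]
      have : A⁻¹ * (A * s⁻¹ * A⁻¹) * A⁻¹⁻¹ = s⁻¹ := by group
      rw [this]
      simpa using hs)
  refine false_of_nonhorospherical_infty (w := A • w) (T := T.map φ) (F := φ '' F) (C := C)
    ?_ ?_ ?_ ?_ ?_ ⟨(A : GL (Fin 2) ℝ) • q, hbwd q hq, ?_⟩ fun R => ?_
  · rw [← MulHom.map_mclosure, hF]
  · rintro _ ⟨f, hf, rfl⟩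
    rw [hsm, sqDist_smul]
    exact hC f hf
  · rintro _ ⟨v, hv, rfl⟩
    rw [hsm, hA, hA]
    exact hle v hv
  · intro r hr
    have h1 := hfwd _ (hsub (by simpa using hbwd' r hr))
    simpa [smul_smul] using h1
  · rw [← hAp]
    exact hbwd p hp
  · intro h
    rw [← hAp] at h
    exact hqp (MulAction.injective _ h)
  · obtain ⟨u, hu, hlt⟩ := hbad R
    refine ⟨φ u, ⟨u, hu, rfl⟩, ?_⟩
    rintro t (rfl | ⟨_, ⟨v, hv, rfl⟩, rfl⟩)
    · rw [hsm, sqDist_smul]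
      exact hlt u (Or.inl rfl)
    · rw [← map_mul, hsm, sqDist_smul]
      exact hlt _ (mul_mem_cone_self hv)

/-! ### Compactness and invertibility -/

/-- The matrices that move `w` by a bounded distance have bounded entries. -/
lemma exists_abs_entry_le (w : ℍ) (R : ℝ) :
    ∃ B : ℝ, ∀ g : SL(2, ℝ), sqDist (g • w) w ≤ R → ∀ i j, |g i j| ≤ B := by
  have hy := w.im_pos
  -- `E` bounds `|cw + d|²` and `|aw + b|² = |gw|²|cw + d|²`; each bounds a row of entries by `B`.
  set E : ℝ := (|R| + 2) + (|R| + 2) * (2 * (|R| * ((|R| + 2) * w.im ^ 2)) + 2 * ‖(w : ℂ)‖ ^ 2)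
    with hE
  set B : ℝ := (√E / w.im) * (1 + |w.re|) + √E with hB
  have hR0 := abs_nonneg R
  have hRE : |R| + 2 ≤ E := by
    have : 0 ≤ (|R| + 2) * (2 * (|R| * ((|R| + 2) * w.im ^ 2)) + 2 * ‖(w : ℂ)‖ ^ 2) := by
      positivity
    linarith
  have hrow : ∀ a b : ℝ, (a * w.re + b) ^ 2 + (a * w.im) ^ 2 ≤ E → |a| ≤ B ∧ |b| ≤ B := by
    intro a b h
    have h1 : |a * w.re + b| ≤ √E := Real.abs_le_sqrt (by nlinarith)
    have h2 : |a * w.im| ≤ √E := Real.abs_le_sqrt (by nlinarith)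
    have h3 : |a| ≤ √E / w.im := by
      rw [le_div_iff₀ hy]
      rwa [abs_mul, abs_of_pos hy] at h2
    have h4 : |b| ≤ |a * w.re + b| + |a| * |w.re| := by
      rw [← abs_mul]
      calc |b| = |(a * w.re + b) - a * w.re| := by ring_nf
        _ ≤ _ := abs_sub _ _
    have h5 : 0 ≤ √E := Real.sqrt_nonneg _
    have h6 : |a| * |w.re| ≤ √E / w.im * |w.re| := by gcongr
    have h7 : 0 ≤ √E / w.im * |w.re| := by positivity
    have h8 : 0 ≤ √E / w.im := by positivity
    constructor <;> rw [hB, mul_add, mul_one] <;> linarith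
  refine ⟨B, fun g hg => ?_⟩
  have ht := (g • w).im_pos
  set z := g • w with hz
  have hΔ := normSq_denom_pos g w
  rw [sqDist, div_le_iff₀ (by positivity)] at hg
  have hg' : ‖(z : ℂ) - w‖ ^ 2 ≤ |R| * (z.im * w.im) :=
    hg.trans (mul_le_mul_of_nonneg_right (le_abs_self R) (by positivity))
  have him : (z.im - w.im) ^ 2 ≤ |R| * (z.im * w.im) := by
    rw [norm_sub_sq] at hg'
    nlinarith [sq_nonneg (z.re - w.re)]
  -- From `(y - y')² ≤ |R|yy'`, each height is at most `|R| + 2` times the other.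
  have h1 : z.im ≤ (|R| + 2) * w.im := by
    by_contra! h
    nlinarith
  have h2 : w.im ≤ (|R| + 2) * z.im := by
    by_contra! h
    nlinarith
  have hzim : z.im = w.im / ((g 1 0 * w.re + g 1 1) ^ 2 + (g 1 0 * w.im) ^ 2) := im_smul_eq g w
  have hdenom : (g 1 0 * w.re + g 1 1) ^ 2 + (g 1 0 * w.im) ^ 2 ≤ |R| + 2 := by
    rw [hzim, ← mul_div_assoc, le_div_iff₀ hΔ] at h2
    by_contra! h
    nlinarith
  have hznorm : ‖(z : ℂ)‖ ^ 2 ≤ 2 * (|R| * ((|R| + 2) * w.im ^ 2)) + 2 * ‖(w : ℂ)‖ ^ 2 := by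
    have h3 : ‖(z : ℂ)‖ ≤ ‖(z : ℂ) - w‖ + ‖(w : ℂ)‖ := by
      simpa using norm_add_le ((z : ℂ) - w) w
    have h4 : ‖(z : ℂ)‖ ^ 2 ≤ (‖(z : ℂ) - w‖ + ‖(w : ℂ)‖) ^ 2 :=
      pow_le_pow_left₀ (norm_nonneg _) h3 2
    have h5 : |R| * (z.im * w.im) ≤ |R| * ((|R| + 2) * w.im ^ 2) := by
      refine mul_le_mul_of_nonneg_left ?_ hR0
      nlinarith
    nlinarith [sq_nonneg (‖(z : ℂ) - w‖ - ‖(w : ℂ)‖)]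
  have hnum : (g 0 0 * w.re + g 0 1) ^ 2 + (g 0 0 * w.im) ^ 2 =
      ‖(z : ℂ)‖ ^ 2 * ((g 1 0 * w.re + g 1 1) ^ 2 + (g 1 0 * w.im) ^ 2) := by
    have h := coe_smul_eq g w
    rw [eq_div_iff (denom_ne g w)] at h
    have h' := congrArg Complex.normSq h
    rw [Complex.normSq_mul, Complex.normSq_eq_norm_sq ((g • w : ℍ) : ℂ), ← hz] at h'
    simp only [Complex.normSq_apply] at h'
    simp at h'
    linarith
  have hd0 : (g 1 0 * w.re + g 1 1) ^ 2 + (g 1 0 * w.im) ^ 2 ≤ E := hdenom.trans hRE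
  have hn0 : (g 0 0 * w.re + g 0 1) ^ 2 + (g 0 0 * w.im) ^ 2 ≤ E := by
    rw [hnum, mul_comm]
    have : ((g 1 0 * w.re + g 1 1) ^ 2 + (g 1 0 * w.im) ^ 2) * ‖(z : ℂ)‖ ^ 2 ≤
        (|R| + 2) * (2 * (|R| * ((|R| + 2) * w.im ^ 2)) + 2 * ‖(w : ℂ)‖ ^ 2) := by
      gcongr
    linarith
  have hr0 := hrow _ _ hn0
  have hr1 := hrow _ _ hd0
  intro i j
  fin_cases i <;> fin_cases j
  exacts [hr0.1, hr0.2, hr1.1, hr1.2]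

/-- A bounded sequence of matrices contains two matrices that are arbitrarily close. -/
lemma exists_lt_inv_mul_near_one {u : ℕ → SL(2, ℝ)} {B : ℝ} (hB : ∀ n i j, |u n i j| ≤ B)
    {ε : ℝ} (hε : 0 < ε) : ∃ m n, m < n ∧
      ∀ i j, |((u m)⁻¹ * u n) i j - (1 : SL(2, ℝ)) i j| < ε := by
  let x : ℕ → Fin 2 → Fin 2 → ℝ := fun n i j => u n i j
  have hx : ∀ n, x n ∈ Metric.closedBall (0 : Fin 2 → Fin 2 → ℝ) B := by
    intro n
    have hB0 : 0 ≤ B := (abs_nonneg _).trans (hB 0 0 0)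
    rw [mem_closedBall_zero_iff, pi_norm_le_iff_of_nonneg hB0]
    intro i
    rw [pi_norm_le_iff_of_nonneg hB0]
    exact fun j => hB n i j
  obtain ⟨a, -, φ, hφ, ha⟩ := (isCompact_closedBall (0 : Fin 2 → Fin 2 → ℝ) B).tendsto_subseq hx
  have hent : ∀ i j, Tendsto (fun n => u (φ n) i j) atTop (𝓝 (a i j)) := fun i j =>
    tendsto_pi_nhds.1 (tendsto_pi_nhds.1 ha i) j
  have hent' : ∀ i j, Tendsto (fun n => u (φ (n + 1)) i j) atTop (𝓝 (a i j)) := fun i j =>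
    (hent i j).comp (tendsto_add_atTop_nat 1)
  have hdet : a 0 0 * a 1 1 - a 0 1 * a 1 0 = 1 := by
    refine tendsto_nhds_unique (((hent 0 0).mul (hent 1 1)).sub ((hent 0 1).mul (hent 1 0))) ?_
    simp only [det_eq]
    exact tendsto_const_nhds
  have hlim : ∀ i j, Tendsto (fun n => ((u (φ n))⁻¹ * u (φ (n + 1))) i j) atTop
      (𝓝 ((1 : SL(2, ℝ)) i j)) := by
    intro i j
    have hexp : ∀ n, (((u (φ n))⁻¹ * u (φ (n + 1)) : SL(2, ℝ)) : Matrix (Fin 2) (Fin 2) ℝ) =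
        !![u (φ n) 1 1, -u (φ n) 0 1; -u (φ n) 1 0, u (φ n) 0 0] *
          (u (φ (n + 1)) : Matrix (Fin 2) (Fin 2) ℝ) := by
      intro n
      rw [Matrix.SpecialLinearGroup.SL2_inv_expl]
      rfl
    simp only [hexp]
    fin_cases i <;> fin_cases j <;> simp [Matrix.mul_apply, Fin.sum_univ_two]
    · have := ((hent 1 1).mul (hent' 0 0)).add ((hent 0 1).mul (hent' 1 0)).neg
      convert this using 2
      rw [← hdet]; ring
    · have := ((hent 1 1).mul (hent' 0 1)).add ((hent 0 1).mul (hent' 1 1)).neg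
      convert this using 2
      ring
    · have := ((hent 1 0).mul (hent' 0 0)).neg.add ((hent 0 0).mul (hent' 1 0))
      convert this using 2
      ring
    · have := ((hent 1 0).mul (hent' 0 1)).neg.add ((hent 0 0).mul (hent' 1 1))
      convert this using 2
      rw [← hdet]; ring
  have hev : ∀ᶠ n in atTop, ∀ i j,
      |((u (φ n))⁻¹ * u (φ (n + 1))) i j - (1 : SL(2, ℝ)) i j| < ε := by
    rw [eventually_all]
    intro i
    rw [eventually_all]
    intro j
    simpa [Real.dist_eq] using (Metric.tendsto_nhds.1 (hlim i j)) ε hε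
  obtain ⟨n, hn⟩ := hev.exists
  exact ⟨φ n, φ (n + 1), hφ n.lt_succ_self, hn⟩

/-- If the orbit of every cone returns to a bounded region, then semidiscreteness makes every
element of the semigroup invertible. -/
theorem exists_mul_eq_one {G : Type*} [Group G] (φ : SL(2, ℝ) →* G) {w : ℍ}
    {T : Subsemigroup SL(2, ℝ)} {R : ℝ}
    (hR : ∀ u ∈ T, ∃ t ∈ cone T u, sqDist (t • w) w ≤ R) {ε : ℝ} (hε : 0 < ε)
    (hsd : ∀ g ∈ T, (∀ i j, |g i j - (1 : SL(2, ℝ)) i j| < ε) → φ g = 1)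
    {s : SL(2, ℝ)} (hs : s ∈ T) : ∃ t ∈ T, φ s * φ t = 1 := by
  choose! next hnext hbound using hR
  -- Inserting `s` before each return makes every quotient `(u m)⁻¹ * u n`, `m < n`, begin with `s`.
  let u : ℕ → SL(2, ℝ) := fun n => Nat.rec (next s) (fun _ t => next (t * s)) n
  have hsucc : ∀ n, u (n + 1) = next (u n * s) := fun n => rfl
  have huT : ∀ n, u n ∈ T := by
    intro n
    induction n with
    | zero => exact mem_of_mem_cone hs (hnext s hs)
    | succ n ih =>
      rw [hsucc]
      exact mem_of_mem_cone (T.mul_mem ih hs) (hnext _ (T.mul_mem ih hs))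
  have hub : ∀ n, sqDist (u n • w) w ≤ R := by
    intro n
    cases n with
    | zero => exact hbound s hs
    | succ n => exact hbound _ (T.mul_mem (huT n) hs)
  have hstep : ∀ n, ∃ k ∈ cone T s, u (n + 1) = u n * k := by
    intro n
    rcases hnext _ (T.mul_mem (huT n) hs) with h | ⟨v, hv, h⟩
    · exact ⟨s, Or.inl rfl, h⟩
    · exact ⟨s * v, mul_mem_cone_self hv, by rw [hsucc, h, mul_assoc]⟩
  have hcone : ∀ m n, m < n → (u m)⁻¹ * u n ∈ cone T s := by
    intro m n hmn
    induction n, hmn using Nat.le_induction with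
    | base =>
      obtain ⟨k, hk, h⟩ := hstep m
      rw [h, inv_mul_cancel_left]
      exact hk
    | succ n hn ih =>
      obtain ⟨k, hk, h⟩ := hstep n
      rw [h, ← mul_assoc]
      exact mul_mem_cone ih (mem_of_mem_cone hs hk)
  obtain ⟨B, hB⟩ := exists_abs_entry_le w R
  obtain ⟨m, n, hmn, hclose⟩ := exists_lt_inv_mul_near_one (fun n => hB (u n) (hub n)) hε
  have hmem := hcone m n hmn
  have hone := hsd _ (mem_of_mem_cone hs hmem) hclose
  rcases hmem with h | ⟨v, hv, h⟩
  · rw [h] at hone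
    exact ⟨s, hs, by rw [hone, mul_one]⟩
  · rw [h, map_mul] at hone
    exact ⟨v, hv, hone⟩

/-! ### From matrices to Möbius transformations -/

/-- The Möbius transformation given by a unimodular real matrix. -/
def toMoebius : SL(2, ℝ) →* RealMoebius where
  toFun g := ⟨MulAction.toPermHom (GL (Fin 2) ℂ) (OnePoint ℂ)
      (Matrix.GeneralLinearGroup.map Complex.ofRealHom (g : GL (Fin 2) ℝ)),
    ⟨(g : GL (Fin 2) ℝ), by simp [Matrix.GLPos], rfl⟩⟩
  map_one' := Subtype.ext (by simp only [map_one]; rfl)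
  map_mul' g h := Subtype.ext (by simp only [map_mul]; rfl)

lemma toMoebius_infty (g : SL(2, ℝ)) : (toMoebius g).1 OnePoint.infty =
    if g 1 0 = 0 then OnePoint.infty
    else ((((g 0 0 : ℝ) : ℂ) / ((g 1 0 : ℝ) : ℂ) : ℂ) : OnePoint ℂ) := by
  change (Matrix.GeneralLinearGroup.map Complex.ofRealHom (g : GL (Fin 2) ℝ)) •
    (OnePoint.infty : OnePoint ℂ) = _
  rw [OnePoint.smul_infty_eq_ite]
  simp

lemma toMoebius_coe (g : SL(2, ℝ)) (z : ℂ) : (toMoebius g).1 (z : OnePoint ℂ) =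
    if ((g 1 0 : ℝ) : ℂ) * z + ((g 1 1 : ℝ) : ℂ) = 0 then OnePoint.infty
    else (((((g 0 0 : ℝ) : ℂ) * z + ((g 0 1 : ℝ) : ℂ)) /
      (((g 1 0 : ℝ) : ℂ) * z + ((g 1 1 : ℝ) : ℂ)) : ℂ) : OnePoint ℂ) := by
  change (Matrix.GeneralLinearGroup.map Complex.ofRealHom (g : GL (Fin 2) ℝ)) •
    (z : OnePoint ℂ) = _
  rw [OnePoint.smul_some_eq_ite]
  simp

lemma toMoebius_coe_upperHalfPlane (g : SL(2, ℝ)) (z : ℍ) :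
    (toMoebius g).1 ((z : ℂ) : OnePoint ℂ) = (((g • z : ℍ) : ℂ) : OnePoint ℂ) := by
  rw [toMoebius_coe, if_neg (denom_ne g z), coe_smul_eq]

lemma toMoebius_surjective : Function.Surjective toMoebius := by
  rintro ⟨_, ⟨γ, hγ, rfl⟩⟩
  have hdet : 0 < (γ : Matrix (Fin 2) (Fin 2) ℝ).det := by simpa using hγ
  set r : ℝ := √(γ : Matrix (Fin 2) (Fin 2) ℝ).det with hr
  have hr0 : 0 < r := Real.sqrt_pos.2 hdet
  have hr2 : r * r = (γ : Matrix (Fin 2) (Fin 2) ℝ).det := Real.mul_self_sqrt hdet.le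
  obtain ⟨g, hg⟩ : ∃ g : SL(2, ℝ), ∀ i j, γ i j = r * g i j := by
    refine ⟨⟨r⁻¹ • (γ : Matrix (Fin 2) (Fin 2) ℝ), ?_⟩, fun i j => ?_⟩
    · rw [Matrix.det_smul, ← hr2]
      simp
      field_simp
    · change γ i j = r * (r⁻¹ * γ i j)
      field_simp
  have hrC : (r : ℂ) ≠ 0 := by exact_mod_cast hr0.ne'
  refine ⟨g, Subtype.ext (Equiv.ext fun p => ?_)⟩
  change _ = (Matrix.GeneralLinearGroup.map Complex.ofRealHom γ) • p
  induction p using OnePoint.rec with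
  | infty =>
    rw [toMoebius_infty, OnePoint.smul_infty_eq_ite]
    simp [hg, hr0.ne', mul_div_mul_left _ _ hrC]
  | coe z =>
    rw [toMoebius_coe, OnePoint.smul_some_eq_ite]
    simp [hg, mul_assoc, ← mul_add, hrC, mul_div_mul_left _ _ hrC]

lemma one_add_div_two_le_sqrt (x : ℝ) : (1 + x) / 2 ≤ √(1 + x ^ 2) := by
  refine Real.le_sqrt_of_sq_le ?_
  nlinarith [sq_nonneg (x - 1), sq_nonneg (x + 1)]

lemma mul_div_two_le_sqrt_mul_sqrt {x y : ℝ} :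
    (1 + x) * (1 + y) / 2 ≤ √(1 + x ^ 2) * √(1 + y ^ 2) := by
  rw [← Real.sqrt_mul (by positivity)]
  refine Real.le_sqrt_of_sq_le ?_
  have hx : (1 + x) ^ 2 ≤ 2 * (1 + x ^ 2) := by nlinarith [sq_nonneg (x - 1)]
  have hy : (1 + y) ^ 2 ≤ 2 * (1 + y ^ 2) := by nlinarith [sq_nonneg (y - 1)]
  have := mul_le_mul hx hy (by positivity) (by positivity)
  nlinarith

/-- A matrix close to the identity acts as a transformation close to the identity. -/
lemma uniformDist_toMoebius_le {g : SL(2, ℝ)} {ε : ℝ} (hε : ε ≤ 1 / 4)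
    (hg : ∀ i j, |g i j - (1 : SL(2, ℝ)) i j| < ε) : uniformDist (toMoebius g) 1 ≤ 8 * ε := by
  have h00 : ‖((g 0 0 : ℝ) : ℂ) - 1‖ ≤ ε := by
    have := (hg 0 0).le
    simp at this
    rwa [← Complex.ofReal_one, ← Complex.ofReal_sub, Complex.norm_real]
  have h01 : ‖((g 0 1 : ℝ) : ℂ)‖ ≤ ε := by
    have := (hg 0 1).le
    simp at this
    rwa [Complex.norm_real]
  have h10 : ‖((g 1 0 : ℝ) : ℂ)‖ ≤ ε := by
    have := (hg 1 0).le
    simp at this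
    rwa [Complex.norm_real]
  have h11 : ‖((g 1 1 : ℝ) : ℂ) - 1‖ ≤ ε := by
    have := (hg 1 1).le
    simp at this
    rwa [← Complex.ofReal_one, ← Complex.ofReal_sub, Complex.norm_real]
  have hε0 : 0 ≤ ε := (norm_nonneg _).trans h01
  refine ciSup_le fun p => ?_
  change chordal ((toMoebius g).1 p) p ≤ _
  induction p using OnePoint.rec with
  | infty =>
    rw [toMoebius_infty]
    split_ifs with hc
    · change (0 : ℝ) ≤ _
      positivity
    · change 2 / √(1 + ‖((g 0 0 : ℝ) : ℂ) / ((g 1 0 : ℝ) : ℂ)‖ ^ 2) ≤ _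
      have hc' : 0 < ‖((g 1 0 : ℝ) : ℂ)‖ := by simpa using hc
      generalize ((g 0 0 : ℝ) : ℂ) = a at *
      generalize ((g 1 0 : ℝ) : ℂ) = c at *
      have ha : 3 / 4 ≤ ‖a‖ := by
        have := norm_sub_norm_le 1 (1 - a)
        rw [norm_sub_rev 1 a] at this
        simp at this
        linarith
      have h1 := one_add_div_two_le_sqrt ‖a / c‖
      refine (div_le_div_of_nonneg_left (by norm_num) (by positivity) h1).trans ?_
      rw [norm_div, div_le_iff₀ (by positivity)]
      have : 1 * ‖c‖ ≤ (2 * ε * (1 + ‖a‖ / ‖c‖)) * ‖c‖ := by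
        have : (2 * ε * (1 + ‖a‖ / ‖c‖)) * ‖c‖ = 2 * ε * (‖c‖ + ‖a‖) := by field_simp
        rw [this]
        nlinarith
      have := le_of_mul_le_mul_right this hc'
      linarith
  | coe z =>
    rw [toMoebius_coe]
    generalize ((g 0 0 : ℝ) : ℂ) = a at *
    generalize ((g 0 1 : ℝ) : ℂ) = b at *
    generalize ((g 1 0 : ℝ) : ℂ) = c at *
    generalize ((g 1 1 : ℝ) : ℂ) = d at *
    have hz := norm_nonneg z
    have hE : 1 - ε * (1 + ‖z‖) ≤ ‖c * z + d‖ := by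
      have h1 : ‖1 - (c * z + d)‖ ≤ ε * (1 + ‖z‖) := by
        calc ‖1 - (c * z + d)‖ = ‖c * z + (d - 1)‖ := by rw [norm_sub_rev]; ring_nf
          _ ≤ ‖c‖ * ‖z‖ + ‖d - 1‖ := (norm_add_le _ _).trans (by rw [norm_mul])
          _ ≤ ε * ‖z‖ + ε := by gcongr
          _ = _ := by ring
      have := norm_sub_norm_le 1 (1 - (c * z + d))
      simp only [sub_sub_cancel, norm_one] at this
      linarith
    have hN : ‖z‖ - ε * (1 + ‖z‖) ≤ ‖a * z + b‖ := by
      have h1 : ‖z - (a * z + b)‖ ≤ ε * (1 + ‖z‖) := by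
        calc ‖z - (a * z + b)‖ = ‖(a - 1) * z + b‖ := by rw [norm_sub_rev]; ring_nf
          _ ≤ ‖a - 1‖ * ‖z‖ + ‖b‖ := (norm_add_le _ _).trans (by rw [norm_mul])
          _ ≤ ε * ‖z‖ + ε := by gcongr
          _ = _ := by ring
      have := norm_sub_norm_le z (z - (a * z + b))
      simp only [sub_sub_cancel] at this
      linarith
    split_ifs with hc
    · change 2 / √(1 + ‖z‖ ^ 2) ≤ _
      rw [hc, norm_zero] at hE
      have h1 := one_add_div_two_le_sqrt ‖z‖
      refine (div_le_div_of_nonneg_left (by norm_num) (by positivity) h1).trans ?_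
      rw [div_le_iff₀ (by positivity)]
      linarith
    · change 2 * ‖(a * z + b) / (c * z + d) - z‖ /
        (√(1 + ‖(a * z + b) / (c * z + d)‖ ^ 2) * √(1 + ‖z‖ ^ 2)) ≤ _
      have hE0 : 0 < ‖c * z + d‖ := norm_pos_iff.2 hc
      refine (div_le_div_of_nonneg_left (by positivity) (by positivity)
        mul_div_two_le_sqrt_mul_sqrt).trans ?_
      rw [div_le_iff₀ (by positivity)]
      have hdiff : (a * z + b) / (c * z + d) - z = ((a * z + b) - z * (c * z + d)) / (c * z + d) := by
        rw [sub_div, mul_div_cancel_right₀ _ hc]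
      have hnum : ‖(a * z + b) - z * (c * z + d)‖ ≤ ε * (1 + ‖z‖) ^ 2 := by
        calc ‖(a * z + b) - z * (c * z + d)‖ =
            ‖(a - 1) * z + b - c * z * z - (d - 1) * z‖ := by ring_nf
          _ ≤ ‖a - 1‖ * ‖z‖ + ‖b‖ + ‖c‖ * ‖z‖ * ‖z‖ + ‖d - 1‖ * ‖z‖ := by
            refine (norm_sub_le _ _).trans (add_le_add ((norm_sub_le _ _).trans (add_le_add
              ((norm_add_le _ _).trans ?_) ?_)) ?_) <;> simp
          _ ≤ ε * ‖z‖ + ε + ε * ‖z‖ * ‖z‖ + ε * ‖z‖ := by gcongr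
          _ = _ := by ring
      rw [hdiff, norm_div, norm_div]
      -- Numerator and denominator cannot both be small when `ε ≤ 1/4`. Their sum is `|cz + d|(1 +
      -- |gz|)`, so the chordal weight of `gz` compensates for a pole near `z`.
      have hsum : (1 + ‖z‖) / 2 ≤ ‖c * z + d‖ + ‖a * z + b‖ := by nlinarith
      have hmain : ε * (1 + ‖z‖) ^ 2 ≤ 2 * ε * (‖c * z + d‖ + ‖a * z + b‖) * (1 + ‖z‖) := by
        have : ε * (1 + ‖z‖) * ((1 + ‖z‖) / 2) ≤
            ε * (1 + ‖z‖) * (‖c * z + d‖ + ‖a * z + b‖) := by gcongr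
        nlinarith
      have hfin : ‖a * z + b - z * (c * z + d)‖ / ‖c * z + d‖ ≤
          2 * ε * (1 + ‖a * z + b‖ / ‖c * z + d‖) * (1 + ‖z‖) := by
        rw [div_le_iff₀ hE0]
        have : 2 * ε * (1 + ‖a * z + b‖ / ‖c * z + d‖) * (1 + ‖z‖) * ‖c * z + d‖ =
            2 * ε * (‖c * z + d‖ + ‖a * z + b‖) * (1 + ‖z‖) := by
          generalize ‖c * z + d‖ = e at *
          field_simp
        rw [this]
        exact hnum.trans hmain
      linarith

/-! ### Chordal limit sets and generators under the lift -/

/-- The inclusion of the extended real line into the extended complex plane. -/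
def ofRealPoint : OnePoint ℝ → OnePoint ℂ := OnePoint.map Complex.ofReal

lemma ofRealPoint_injective : Function.Injective ofRealPoint := by
  intro p q h
  induction p using OnePoint.rec <;> induction q using OnePoint.rec <;>
    simp_all [ofRealPoint]

lemma range_ofRealPoint : Set.range ofRealPoint = extendedRealLine := by
  ext p
  constructor
  · rintro ⟨q, rfl⟩
    induction q using OnePoint.rec with
    | infty => exact Or.inl rfl
    | coe x => exact Or.inr ⟨x, rfl⟩
  · rintro (rfl | ⟨x, rfl⟩)
    · exact ⟨OnePoint.infty, rfl⟩
    · exact ⟨(x : OnePoint ℝ), rfl⟩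

lemma coe_upperHalfPlane_ne_ofRealPoint (z : ℍ) (p : OnePoint ℝ) :
    ((z : ℂ) : OnePoint ℂ) ≠ ofRealPoint p := by
  induction p using OnePoint.rec with
  | infty => simp [ofRealPoint]
  | coe x =>
    intro h
    have h : (z : ℂ) = x := OnePoint.coe_injective h
    have := congrArg Complex.im h
    simp at this
    exact z.im_pos.ne' this

/-- Accumulation with respect to the chordal metric at a point of the extended real line. -/
lemma frequently_boundaryFilter_iff (p : OnePoint ℝ) (A : Set ℍ) :
    (∃ᶠ z in boundaryFilter p, z ∈ A) ↔
      ∀ ε : ℝ, 0 < ε → ∃ z ∈ A, chordal ((z : ℂ) : OnePoint ℂ) (ofRealPoint p) < ε := by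
  induction p using OnePoint.rec with
  | infty =>
    have hch : ∀ z : ℍ, chordal ((z : ℂ) : OnePoint ℂ) (ofRealPoint OnePoint.infty) =
        2 / √(1 + ‖(z : ℂ)‖ ^ 2) := fun z => rfl
    simp only [hch]
    constructor
    · intro h ε hε
      have hev : ∀ᶠ z : ℍ in boundaryFilter OnePoint.infty, 2 / ε < ‖(z : ℂ)‖ :=
        (tendsto_norm_cobounded_atTop.comp tendsto_comap).eventually_gt_atTop _
      obtain ⟨z, hz, hB⟩ := (h.and_eventually hev).exists
      refine ⟨z, hz, ?_⟩
      rw [div_lt_iff₀ (by positivity)]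
      rw [div_lt_iff₀ hε] at hB
      have : ‖(z : ℂ)‖ ≤ √(1 + ‖(z : ℂ)‖ ^ 2) := Real.le_sqrt_of_sq_le (by linarith)
      nlinarith
    · intro h
      have hb := (Metric.hasBasis_cobounded_compl_closedBall (0 : ℂ)).comap
        (fun z : ℍ => (z : ℂ))
      refine hb.frequently_iff.2 ?_
      intro B _
      obtain ⟨z, hz, hlt⟩ := h (2 / √(1 + B ^ 2)) (by positivity)
      refine ⟨z, ?_, hz⟩
      rw [div_lt_div_iff_of_pos_left (by norm_num) (by positivity) (by positivity),
        Real.sqrt_lt_sqrt_iff (by positivity)] at hlt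
      have : B < ‖(z : ℂ)‖ := by
        by_contra! h
        nlinarith [norm_nonneg (z : ℂ)]
      simpa using this
  | coe x =>
    have hch : ∀ z : ℍ, chordal ((z : ℂ) : OnePoint ℂ) (ofRealPoint (x : OnePoint ℝ)) =
        2 * ‖(z : ℂ) - x‖ / (√(1 + ‖(z : ℂ)‖ ^ 2) * √(1 + ‖(x : ℂ)‖ ^ 2)) := fun z => rfl
    simp only [hch]
    have hb := (Metric.nhds_basis_ball (x := (x : ℂ))).comap (fun z : ℍ => (z : ℂ))
    refine hb.frequently_iff.trans ?_
    have hone : ∀ y : ℝ, 1 ≤ √(1 + y ^ 2) := fun y =>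
      Real.le_sqrt_of_sq_le (by nlinarith [sq_nonneg y])
    have hle : ∀ y : ℝ, 0 ≤ y → √(1 + y ^ 2) ≤ 1 + y := fun y hy =>
      Real.sqrt_le_iff.2 ⟨by linarith, by nlinarith⟩
    constructor
    · intro h ε hε
      obtain ⟨z, hz, hzA⟩ := h (ε / 2) (by positivity)
      refine ⟨z, hzA, ?_⟩
      have hz : ‖(z : ℂ) - x‖ < ε / 2 := by simpa [dist_eq_norm] using hz
      have h1 : 1 ≤ √(1 + ‖(z : ℂ)‖ ^ 2) * √(1 + ‖(x : ℂ)‖ ^ 2) :=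
        one_le_mul_of_one_le_of_one_le (hone _) (hone _)
      refine (div_le_self (by positivity) h1).trans_lt ?_
      linarith
    · intro h ε hε
      set X : ℝ := 1 + ‖(x : ℂ)‖ with hX
      have hX0 : 0 < X := by positivity
      -- With `t = ‖z - x‖`, the chordal distance is at least `2t/((X + t)X)`, which increases in
      -- `t`; the witness is its value at `t = ε`.
      obtain ⟨z, hzA, hz⟩ := h (2 * ε / ((X + ε) * X)) (by positivity)
      refine ⟨z, ?_, hzA⟩
      have hzx : √(1 + ‖(z : ℂ)‖ ^ 2) ≤ X + ‖(z : ℂ) - x‖ := by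
        refine (hle _ (norm_nonneg _)).trans ?_
        have := norm_add_le ((z : ℂ) - x) x
        simp only [sub_add_cancel] at this
        linarith
      have hxx : √(1 + ‖(x : ℂ)‖ ^ 2) ≤ X := hle _ (norm_nonneg _)
      have hlt : 2 * ‖(z : ℂ) - x‖ / ((X + ‖(z : ℂ) - x‖) * X) < 2 * ε / ((X + ε) * X) := by
        refine lt_of_le_of_lt ?_ hz
        gcongr
      rw [div_lt_div_iff₀ (by positivity) (by positivity)] at hlt
      have : ‖(z : ℂ) - x‖ < ε := by
        by_contra! hge
        have h1 : 0 ≤ X * X * (‖(z : ℂ) - x‖ - ε) := by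
          have := sub_nonneg.2 hge
          positivity
        nlinarith
      simpa [dist_eq_norm] using this

/-- The clause `a ≠ p` in the definition of accumulation is automatic, since the orbit lies in `ℍ`
and `p` on the extended real line. -/
lemma forwardLimitSet_eq_image (w : ℍ) (S : Set RealMoebius) :
    forwardLimitSet w S = ofRealPoint '' limitSet w (toMoebius ⁻¹' S) := by
  have key : ∀ p : OnePoint ℝ, IsAccumulationPoint chordal (ofRealPoint p) (orbitOf w S) ↔
      p ∈ limitSet w (toMoebius ⁻¹' S) := by
    intro p
    refine Iff.trans ?_ (frequently_boundaryFilter_iff p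
      {z | ∃ v ∈ toMoebius ⁻¹' S, v • w = z}).symm
    refine forall₂_congr fun ε _ => ⟨?_, ?_⟩
    · rintro ⟨_, ⟨s, hs, rfl⟩, -, hlt⟩
      obtain ⟨g, rfl⟩ := toMoebius_surjective s
      rw [toMoebius_coe_upperHalfPlane] at hlt
      exact ⟨g • w, ⟨g, hs, rfl⟩, hlt⟩
    · rintro ⟨_, ⟨g, hg, rfl⟩, hlt⟩
      exact ⟨_, ⟨toMoebius g, hg, toMoebius_coe_upperHalfPlane g w⟩,
        coe_upperHalfPlane_ne_ofRealPoint _ _, hlt⟩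
  ext p
  constructor
  · rintro ⟨hp, hacc⟩
    rw [← range_ofRealPoint] at hp
    obtain ⟨q, rfl⟩ := hp
    exact ⟨q, (key q).1 hacc, rfl⟩
  · rintro ⟨q, hq, rfl⟩
    exact ⟨range_ofRealPoint ▸ ⟨q, rfl⟩, (key q).2 hq⟩

/-- Any lift `g` of a product `xy` factors as `h * (h⁻¹ * g)`, a lift of `x` times a lift of `y`. -/
lemma closure_preimage_toMoebius (F : Set RealMoebius) :
    Subsemigroup.closure (toMoebius ⁻¹' F) = (Subsemigroup.closure F).comap toMoebius := by
  refine le_antisymm (Subsemigroup.closure_le.2 fun g hg => Subsemigroup.subset_closure hg) ?_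
  have key : ∀ s ∈ Subsemigroup.closure F, ∀ g, toMoebius g = s →
      g ∈ Subsemigroup.closure (toMoebius ⁻¹' F) := by
    intro s hs
    induction hs using Subsemigroup.closure_induction with
    | mem f hf =>
      rintro g rfl
      exact Subsemigroup.subset_closure hf
    | mul x y hx hy ihx ihy =>
      intro g hg
      obtain ⟨h, rfl⟩ := toMoebius_surjective x
      have := mul_mem (ihx h rfl) (ihy (h⁻¹ * g) (by rw [map_mul, map_inv, hg]; group))
      simpa using this
  exact fun g hg => key _ hg g rfl

/-- All lifts of one transformation move `w` to the same point, so one chosen lift per generator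
suffices. -/
lemma exists_forall_sqDist_le (w : ℍ) {F : Set RealMoebius} (hF : F.Finite) :
    ∃ C : ℝ, ∀ f ∈ toMoebius ⁻¹' F, sqDist (f • w) w ≤ C := by
  let lift := Function.surjInv toMoebius_surjective
  obtain ⟨C, hC⟩ := (hF.image fun s => sqDist (lift s • w) w).bddAbove
  refine ⟨C, fun f hf => ?_⟩
  have h1 : lift (toMoebius f) • w = f • w := by
    have h := congrArg (fun s : RealMoebius => s.1 ((w : ℂ) : OnePoint ℂ))
      (Function.surjInv_eq toMoebius_surjective (toMoebius f))
    simp only [toMoebius_coe_upperHalfPlane] at h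
    exact UpperHalfPlane.ext (OnePoint.coe_injective h)
  have := hC ⟨toMoebius f, hf, rfl⟩
  rwa [← h1]

/-! ### The theorem -/

/-- A finitely generated semidiscrete semigroup whose backward limit set lies in its forward
limit set and is not a singleton is a group. -/
theorem isGroup_of_backwardLimitSet_subset {S : Subsemigroup RealMoebius}
    (hne : (S : Set RealMoebius).Nonempty) (hfg : IsFinitelyGenerated S) (hsd : IsSemidiscrete S)
    {w : ℍ} (hcard : (backwardLimitSet w (S : Set RealMoebius)).encard ≠ 1)
    (hsub : backwardLimitSet w (S : Set RealMoebius) ⊆ forwardLimitSet w (S : Set RealMoebius)) :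
    IsGroup S := by
  obtain ⟨F, hFfin, hF⟩ := hfg
  let T : Subsemigroup SL(2, ℝ) := S.comap toMoebius
  have hfwd : forwardLimitSet w (S : Set RealMoebius) = ofRealPoint '' limitSet w T :=
    forwardLimitSet_eq_image w S
  have hbwd : backwardLimitSet w (S : Set RealMoebius) =
      ofRealPoint '' limitSet w (T : Set SL(2, ℝ))⁻¹ := by
    rw [backwardLimitSet, forwardLimitSet_eq_image]
    congr 2
    ext g
    change (toMoebius g)⁻¹ ∈ S ↔ toMoebius g⁻¹ ∈ S
    rw [map_inv]
  obtain ⟨C, hC⟩ := exists_forall_sqDist_le w hFfin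
  obtain ⟨R, hR⟩ := exists_forall_cone (w := w) (T := T)
    (by rw [closure_preimage_toMoebius, hF]) hC
    (by rwa [hfwd, hbwd, Set.image_subset_image_iff ofRealPoint_injective] at hsub)
    (by
      intro p hp
      by_contra! h
      apply hcard
      rw [hbwd, Set.eq_singleton_iff_unique_mem.2 ⟨hp, h⟩, Set.image_singleton,
        Set.encard_singleton])
  obtain ⟨ε, hε, hsd⟩ : ∃ ε : ℝ, 0 < ε ∧ ∀ g ∈ T,
      (∀ i j, |g i j - (1 : SL(2, ℝ)) i j| < ε) → toMoebius g = 1 := by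
    unfold IsSemidiscrete IsAccumulationPoint at hsd
    push Not at hsd
    obtain ⟨ε, hε, hsd⟩ := hsd
    -- `1/4` is the range of `uniformDist_toMoebius_le`, and `8 · ε/9 < ε`. Only triviality of the
    -- action follows, as `-1` is also a lift of the identity.
    refine ⟨min (1 / 4) (ε / 9), by positivity, fun g hg hclose => ?_⟩
    by_contra hne1
    have h1 : ε ≤ uniformDist (toMoebius g) 1 := hsd _ hg hne1
    have h2 := uniformDist_toMoebius_le (min_le_left _ _) hclose
    have h3 := min_le_right (1 / 4) (ε / 9)
    linarith
  have hinv : ∀ s ∈ S, s⁻¹ ∈ S := by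
    intro s hs
    obtain ⟨g, rfl⟩ := toMoebius_surjective s
    obtain ⟨t, ht, h⟩ := exists_mul_eq_one toMoebius hR hε hsd (s := g) hs
    rw [inv_eq_of_mul_eq_one_right h]
    exact ht
  obtain ⟨s, hs⟩ := hne
  exact ⟨{ carrier := S
           mul_mem' := S.mul_mem
           one_mem' := by simpa using S.mul_mem hs (hinv s hs)
           inv_mem' := fun {x} hx => hinv x hx }, rfl⟩

lemma IsGroup.forwardLimitSet_eq {S : Subsemigroup RealMoebius} (h : IsGroup S) (w : ℍ) :
    forwardLimitSet w (S : Set RealMoebius) = backwardLimitSet w (S : Set RealMoebius) := by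
  obtain ⟨H, hH⟩ := h
  rw [backwardLimitSet, ← hH, inv_coe_set]

end MoebiusSemigroup

end

theorem theorem1p7
    (S : Subsemigroup MoebiusSemigroup.RealMoebius)
    (hne : (S : Set MoebiusSemigroup.RealMoebius).Nonempty)
    (hfg : MoebiusSemigroup.IsFinitelyGenerated S)
    (hsd : MoebiusSemigroup.IsSemidiscrete S)
    (w : UpperHalfPlane)
    (hcard : (MoebiusSemigroup.backwardLimitSet w
      (S : Set MoebiusSemigroup.RealMoebius)).encard ≠ 1) :
    (MoebiusSemigroup.forwardLimitSet w (S : Set MoebiusSemigroup.RealMoebius) =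
        MoebiusSemigroup.backwardLimitSet w (S : Set MoebiusSemigroup.RealMoebius) ↔
      MoebiusSemigroup.IsGroup S) ∧
    (MoebiusSemigroup.backwardLimitSet w (S : Set MoebiusSemigroup.RealMoebius) ⊆
        MoebiusSemigroup.forwardLimitSet w (S : Set MoebiusSemigroup.RealMoebius) →
      MoebiusSemigroup.IsGroup S) := by
  have h := fun hsub =>
    MoebiusSemigroup.isGroup_of_backwardLimitSet_subset hne hfg hsd hcard hsub
  exact ⟨⟨fun heq => h heq.ge, fun hS => hS.forwardLimitSet_eq w⟩, h⟩
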